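/- **Setting.** Let $d\ge 1$ and let $D:\mathbb{Z}^d\to[-\infty,\infty)$ satisfy $D(\mathbf 0)=1$, with $\{x: D(x)\ne-\infty\}$ finite and having at least two elements. Let particles arrive at the sites of $\mathbb{Z}^d$ at the times of independent homogeneous Poisson processes of unit rate. For a substrate $Q$ which is a finite subset of $\mathbb{Z}^d$ or all of $\mathbb{Z}^d$, the lattice ballistic deposition heights $\xi_{t,Q}(z)$, $z\in\mathbb{Z}^d$, $t\ge 0$ (written $\xi_t(z)$ if $Q=\mathbb{Z}^d$) are given by the following rules: $\xi_{0,Q}(z)=0$ for all $z$; for each $z$ the function $t\mapsto\xi_{t,Q}(z)$ is right-continuous and piecewise constant and jumps only at the arrival times at $z$ if $z \in Q$, and never if $z\notin Q$; and if a particle arrives at $z\in Q$ at time $t$, then $\xi_{t,Q}(z)=\lim_{s\uparrow t}\eta_{s,Q}(z)$, where $\eta_{s,Q}(z)=\max_{y\in\mathbb{Z}^d}\{\xi_{s,Q}(y)+D(z-y)\}$. For finite non-empty $Q$ put $$\bar\xi_{t,Q}=|Q|^{-1}\sum_{z\in Q}\xi_{t,Q}(z),\qquad W_{t,Q}=\sqrt{|Q|^{-1}\sum_{z\in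 Q}\bigl(\xi_{t,Q}(z)-\bar\xi_{t,Q}\bigr)^2}.$$ Let $(Q_n)_{n\ge1}$ be finite subsets of $\mathbb{Z}^d$ such that 1. $\mathbf 0\in Q_n$ for all $n$; 2. $\bigcup_{n}\bigcap_{m\ge n}Q_m=\mathbb{Z}^d$; 3. $|\partial Q_n|/|Q_n|\to0$, where $\partial Q_n$ is the set of sites of $Q_n$ that have a nearest neighbour in $\mathbb{Z}^d\setminus Q_n$; 4. $|Q_{n+1}|>|Q_n|$ for all $n$; 5. if $d\ge2$, then $\operatorname{diam}(Q_n)/|Q_n|\to0$, where $\operatorname{diam}$ is the Euclidean diameter. **Proposition.** Almost surely the rules above have exactly one solution for $Q=\mathbb{Z}^d$ and for each $Q=Q_n$. For every $t\in(0,\infty)$ the variable $\xi_t(\mathbf 0)$ is square integrable, and with $h(t)=E[\xi_t(\mathbf 0)]$ and $w^2(t)=\operatorname{Var}[\xi_t(\mathbf 0)]$, $$\bar\xi_{t,Q_n}\longrightarrow h(t)\quad\text{and}\quad W_{t,Q_n}^2\longrightarrow w^2(t)\qquad\text{in }L^1\text{ as }n\to\infty$$ (in particular $\bar\xi_{t,Q_n}$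 and $W_{t,Q_n}^2$ are integrable). -/

import Mathlib

open MeasureTheory ProbabilityTheory Filter Topology
open scoped NNReal ENNReal

noncomputable section

/-- A displacement function `D : ℤ^d → [-∞, ∞)`: `D 0 = 1`, and the neighbourhood
`{x | D x ≠ -∞}` is finite with at least two elements. -/
structure IsDisplacement {d : ℕ} (D : (Fin d → ℤ) → EReal) : Prop where
  ne_top : ∀ x, D x ≠ ⊤
  zero : D 0 = 1
  finite : {x | D x ≠ ⊥}.Finite
  nontrivial : {x | D x ≠ ⊥}.Nontrivial

/-- The next-arrival height at `x` for a configuration `ξ` of last-arrival heights, the maximum of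
`ξ y + D (x - y)` over `y ∈ ℤ^d` (only finitely many of these values differ from `-∞`). -/
def nextHeight {d : ℕ} (D : (Fin d → ℤ) → EReal) (ξ : (Fin d → ℤ) → ℝ) (x : Fin d → ℤ) : EReal :=
  ⨆ y : Fin d → ℤ, ((ξ y : ℝ) : EReal) + D (x - y)

/-- `ξ` is a trajectory of (last-arrival) heights of ballistic deposition, for the deterministic
sets `A z` of arrival times at the sites `z`. -/
structure IsBDTrajectory {d : ℕ} (D : (Fin d → ℤ) → EReal) (A : (Fin d → ℤ) → Set ℝ≥0)
    (ξ : ℝ≥0 → (Fin d → ℤ) → ℝ) : Prop where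
  /-- The initial surface is flat. -/
  init : ∀ z, ξ 0 z = 0
  /-- The height at `z` changes only at the arrival times at `z`, and is right-continuous: it takes
  the same value at `s` and at `t` if there is no arrival at `z` during `(s, t]`. -/
  const : ∀ z s t, s ≤ t → (∀ u ∈ Set.Ioc s t, u ∉ A z) → ξ t z = ξ s z
  /-- At an arrival time `t` at `z` the height at `z` becomes the next-arrival height immediately
  before time `t`. -/
  update : ∀ z, ∀ t ∈ A z,
    Tendsto (fun s => nextHeight D (ξ s) z) (𝓝[<] t) (𝓝 ((ξ t z : ℝ) : EReal))

open Classical in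
/-- The heights of ballistic deposition with arrival times `A`: the trajectory that follows the
evolution rules (zero if there is none). -/
def bdHeight {d : ℕ} (D : (Fin d → ℤ) → EReal) (A : (Fin d → ℤ) → Set ℝ≥0) :
    ℝ≥0 → (Fin d → ℤ) → ℝ :=
  if h : ∃ ξ, IsBDTrajectory D A ξ then h.choose else 0

/-- Only the arrivals at the sites of the substrate `Q` are kept. -/
def restrictArrivals {d : ℕ} (A : (Fin d → ℤ) → Set ℝ≥0) (Q : Finset (Fin d → ℤ)) :
    (Fin d → ℤ) → Set ℝ≥0 :=
  fun z => {t | z ∈ Q ∧ t ∈ A z}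

/-- The mean height over `Q` for deposition onto the substrate `Q`. -/
def bdMeanHeight {d : ℕ} (D : (Fin d → ℤ) → EReal) (A : (Fin d → ℤ) → Set ℝ≥0)
    (Q : Finset (Fin d → ℤ)) (t : ℝ≥0) : ℝ :=
  (Q.card : ℝ)⁻¹ * ∑ z ∈ Q, bdHeight D (restrictArrivals A Q) t z

/-- The width (root mean square deviation of the heights from their mean over `Q`) for deposition
onto the substrate `Q`. -/
def bdWidth {d : ℕ} (D : (Fin d → ℤ) → EReal) (A : (Fin d → ℤ) → Set ℝ≥0)
    (Q : Finset (Fin d → ℤ)) (t : ℝ≥0) : ℝ :=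
  Real.sqrt ((Q.card : ℝ)⁻¹ *
    ∑ z ∈ Q, (bdHeight D (restrictArrivals A Q) t z - bdMeanHeight D A Q t) ^ 2)

/-- `N` is (the counting process of) a homogeneous Poisson process of unit rate on `[0, ∞)`. -/
structure IsUnitPoissonProcess {Ω : Type*} [MeasurableSpace Ω] (N : ℝ≥0 → Ω → ℕ)
    (P : Measure Ω) : Prop where
  measurable : ∀ t, Measurable (N t)
  zero : ∀ᵐ ω ∂P, N 0 ω = 0
  monotone : ∀ᵐ ω ∂P, Monotone fun t => N t ω
  rightCont : ∀ᵐ ω ∂P, ∀ t, ContinuousWithinAt (fun s => N s ω) (Set.Ici t) t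
  indepIncrements : HasIndepIncrements N P
  law : ∀ s t, s ≤ t → HasLaw (fun ω => N t ω - N s ω) (poissonMeasure (t - s)) P

/-- The particles arrive at the sites of `ℤ^d` as independent Poisson processes of unit rate. -/
structure IsPoissonArrivals {d : ℕ} {Ω : Type*} [MeasurableSpace Ω]
    (N : (Fin d → ℤ) → ℝ≥0 → Ω → ℕ) (P : Measure Ω) : Prop where
  poisson : ∀ z, IsUnitPoissonProcess (N z) P
  indep : iIndepFun (fun z ω t => N z t ω) P

/-- The arrival times at each site: the jump times of the counting processes. -/
def arrivalTimes {d : ℕ} {Ω : Type*} (N : (Fin d → ℤ) → ℝ≥0 → Ω → ℕ) (ω : Ω) :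
    (Fin d → ℤ) → Set ℝ≥0 :=
  fun z => {t | 0 < t ∧ ∀ s < t, N z s ω < N z t ω}

open Classical in
/-- The boundary sites in `Q`: the sites of `Q` with a nearest neighbour in `ℤ^d` outside `Q`. -/
def boundarySites {d : ℕ} (Q : Finset (Fin d → ℤ)) : Finset (Fin d → ℤ) :=
  Q.filter fun x => ∃ y, y ∉ Q ∧ ∑ i, |x i - y i| = 1

/-- The Euclidean diameter of `Q`. -/
def latticeDiam {d : ℕ} (Q : Finset (Fin d → ℤ)) : ℝ :=
  Metric.diam ((fun x : Fin d → ℤ => WithLp.toLp 2 (fun i => (x i : ℝ))) ''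
    (Q : Set (Fin d → ℤ)) : Set (EuclideanSpace ℝ (Fin d)))

/-- The standing conditions on the sequence of substrates. For `d = 1` the ratio of the diameter to
the number of sites is at least `1 - 1 / |Q n|`, so the last condition is asked only if `2 ≤ d`. -/
structure IsSubstrateSequence {d : ℕ} (Q : ℕ → Finset (Fin d → ℤ)) : Prop where
  zero_mem : ∀ n, 0 ∈ Q n
  liminf_eq : ⋃ n, ⋂ m ≥ n, (Q m : Set (Fin d → ℤ)) = Set.univ
  boundary : Tendsto (fun n => ((boundarySites (Q n)).card : ℝ) / ((Q n).card : ℝ)) atTop (𝓝 0)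
  card_lt : ∀ n, (Q n).card < (Q (n + 1)).card
  diam : 2 ≤ d → Tendsto (fun n => latticeDiam (Q n) / ((Q n).card : ℝ)) atTop (𝓝 0)

end

/-! The heights are compared with a model in discrete time: time is cut into cells of mesh δ, and a
site is updated once in each cell that contains an arrival. The cells are independent and occupied
with probability at most δ. The model is eventually exact: almost surely, at each site, the discrete
height equals the true one as soon as δ is below the gaps between the finitely many arrivals that
matter (`IsBDTrajectory.eventually_discHeight_eq`). Hence estimates that are uniform in δ pass to
continuous time by Fatou's lemma.

With all displacements equal to 1, the discrete height is the length L of the longest chain of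
occupied cells that influences a site. Bounding a maximum by a sum gives E[exp L] ≤ (1 +
δe|V|)^(t/δ) ≤ exp(te|V|), see `lintegral_exp_discHeight_le`. This bound has three uses. Chains of
arrivals are almost surely bounded in length, so the trajectory exists and is unique by recursion
along chains. Heights are at most a constant times L, so all their moments are bounded. On {L ≤ R}
the height depends only on cells within R steps (`discHeight_congr_of_le`), and the event {L > R}
costs a factor exp(-R/2).

For the law of large numbers, each f(height) is replaced by its version computed from the cells
within R steps. The error is exponentially small in R except at sites close to the boundary, whose
proportion tends to 0. The local versions are identically distributed with finite range of
dependence, so their average over Q has variance of order 1/|Q|. Letting n → ∞ and then R → ∞ gives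
L² convergence of the averages of the heights and of their squares. The squared width is the mean
square minus the squared mean, hence converges in L¹. -/

noncomputable section

open scoped Pointwise

/-! ### Synchronous deposition in discrete time -/

section Discrete

variable {G : Type*} [AddCommGroup G]

/-- The largest of the values `ξ (x - v) + c v`, `v ∈ V`. -/
def stepMax (V : Finset G) (hV : V.Nonempty) (c ξ : G → ℝ) (x : G) : ℝ :=
  V.sup' hV fun v => ξ (x - v) + c v

lemma le_stepMax {V : Finset G} (hV : V.Nonempty) (c ξ : G → ℝ) (x : G) {v : G} (hv : v ∈ V) :
    ξ (x - v) + c v ≤ stepMax V hV c ξ x :=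
  Finset.le_sup' (fun v => ξ (x - v) + c v) hv

lemma stepMax_le_iff {V : Finset G} (hV : V.Nonempty) (c ξ : G → ℝ) (x : G) {a : ℝ} :
    stepMax V hV c ξ x ≤ a ↔ ∀ v ∈ V, ξ (x - v) + c v ≤ a :=
  Finset.sup'_le_iff hV _

lemma stepMax_congr {V : Finset G} (hV : V.Nonempty) (c : G → ℝ) {ξ ξ' : G → ℝ} {x y : G}
    (h : ∀ v ∈ V, ξ (x - v) = ξ' (y - v)) : stepMax V hV c ξ x = stepMax V hV c ξ' y :=
  Finset.sup'_congr hV rfl fun v hv => by rw [h v hv]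

open Classical in
/-- Heights of synchronous deposition in discrete time: at step `i` the sites `z` with `b (i, z)`
are updated. -/
def discHeight (V : Finset G) (hV : V.Nonempty) (c : G → ℝ) (b : ℕ × G → Prop) : ℕ → G → ℝ
  | 0, _ => 0
  | i + 1, z =>
    if b (i, z) then stepMax V hV c (discHeight V hV c b i) z else discHeight V hV c b i z

/-- The occupied cells whose site belongs to `S`. -/
def restrictCells (S : Set G) (b : ℕ × G → Prop) : ℕ × G → Prop := fun p => p.2 ∈ S ∧ b p

variable {V : Finset G} (hV : V.Nonempty) {c : G → ℝ}

lemma discHeight_zero (b : ℕ × G → Prop) (z : G) : discHeight V hV c b 0 z = 0 := rfl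

lemma discHeight_succ_of_mem {b : ℕ × G → Prop} {i : ℕ} {z : G} (h : b (i, z)) :
    discHeight V hV c b (i + 1) z = stepMax V hV c (discHeight V hV c b i) z := by
  rw [discHeight, if_pos h]

lemma discHeight_succ_of_not_mem {b : ℕ × G → Prop} {i : ℕ} {z : G} (h : ¬ b (i, z)) :
    discHeight V hV c b (i + 1) z = discHeight V hV c b i z := by
  rw [discHeight, if_neg h]

lemma discHeight_le_succ (h0 : 0 ∈ V) (hc : 0 ≤ c 0) (b : ℕ × G → Prop) (i : ℕ) (z : G) :
    discHeight V hV c b i z ≤ discHeight V hV c b (i + 1) z := by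
  by_cases h : b (i, z)
  · rw [discHeight_succ_of_mem hV h]
    have := le_stepMax hV c (discHeight V hV c b i) z h0
    rw [sub_zero] at this
    linarith
  · rw [discHeight_succ_of_not_mem hV h]

lemma discHeight_mono (h0 : 0 ∈ V) (hc : 0 ≤ c 0) (b : ℕ × G → Prop) (z : G) :
    Monotone fun i => discHeight V hV c b i z :=
  monotone_nat_of_le_succ fun i => discHeight_le_succ hV h0 hc b i z

lemma discHeight_nonneg (h0 : 0 ∈ V) (hc : 0 ≤ c 0) (b : ℕ × G → Prop) (i : ℕ) (z : G) :
    0 ≤ discHeight V hV c b i z :=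
  discHeight_mono hV h0 hc b z (Nat.zero_le i)

/-- Each step of a chain adds at most `C`, so a height is at most `C` times a chain length. Allowing
more cells in the chain length lets one variable, on the full lattice, dominate the heights for
every substrate. -/
lemma discHeight_le_mul (h0 : 0 ∈ V) {C : ℝ} (hC : 0 ≤ C) (hcC : ∀ v ∈ V, c v ≤ C)
    {b b' : ℕ × G → Prop} (hb : ∀ p, b p → b' p) (i : ℕ) (z : G) :
    discHeight V hV c b i z ≤ C * discHeight V hV (fun _ => 1) b' i z := by
  induction i generalizing z with
  | zero => simp [discHeight_zero]
  | succ i ih =>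
    by_cases h : b (i, z)
    · rw [discHeight_succ_of_mem hV h, discHeight_succ_of_mem hV (hb _ h), stepMax_le_iff]
      intro v hv
      have h1 := le_stepMax hV (fun _ => 1) (discHeight V hV (fun _ => 1) b' i) z hv
      have h2 := mul_le_mul_of_nonneg_left h1 hC
      have := ih (z - v)
      have := hcC v hv
      linarith
    · rw [discHeight_succ_of_not_mem hV h]
      exact (ih z).trans (mul_le_mul_of_nonneg_left
        (discHeight_le_succ hV h0 zero_le_one b' i z) hC)

/-- The displacements reached by at most `R` steps in `V`, if `0 ∈ V`. -/
def stepBall [DecidableEq G] (V : Finset G) : ℕ → Finset G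
  | 0 => {0}
  | R + 1 => V + stepBall V R

lemma zero_mem_stepBall [DecidableEq G] (h0 : 0 ∈ V) (R : ℕ) : 0 ∈ stepBall V R := by
  induction R with
  | zero => simp [stepBall]
  | succ R ih => exact Finset.mem_add.2 ⟨0, h0, 0, ih, add_zero 0⟩

lemma add_mem_stepBall [DecidableEq G] {v w : G} {R : ℕ} (hv : v ∈ V) (hw : w ∈ stepBall V R) :
    v + w ∈ stepBall V (R + 1) := Finset.add_mem_add hv hw

/-- Chain length controls the range of dependence. When `b''` updates a site, the chain lengths at
its neighbours were smaller by at least one, so the radius available to them may drop by one; when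
it does not, neither do `b` and `b'`. -/
lemma discHeight_congr_of_le [DecidableEq G] (h0 : 0 ∈ V) {b b' b'' : ℕ × G → Prop}
    (hb : ∀ p, b p → b'' p) (hb' : ∀ p, b' p → b'' p) (i R : ℕ) (z : G)
    (hR : discHeight V hV (fun _ => 1) b'' i z ≤ R)
    (h : ∀ j, ∀ w ∈ stepBall V R, b (j, z - w) ↔ b' (j, z - w)) :
    discHeight V hV c b i z = discHeight V hV c b' i z := by
  induction i generalizing z R with
  | zero => rfl
  | succ i ih =>
    have hz : b (i, z) ↔ b' (i, z) := by simpa using h i 0 (zero_mem_stepBall h0 R)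
    by_cases hi : b'' (i, z)
    · rw [discHeight_succ_of_mem hV hi, stepMax_le_iff] at hR
      -- Radius 0 is impossible here, as an updated site has chain length at least 1.
      obtain _ | R := R
      · have h1 := hR 0 h0
        have h2 := discHeight_nonneg (V := V) hV (c := fun _ => 1) h0 zero_le_one b'' i (z - 0)
        simp only [Nat.cast_zero] at h1
        linarith
      · have key : ∀ v ∈ V, discHeight V hV c b i (z - v) = discHeight V hV c b' i (z - v) := by
          intro v hv
          refine ih R (z - v) ?_ fun j w hw => ?_
          · have h1 := hR v hv
            push_cast at h1
            linarith
          · rw [sub_sub]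
            exact h j _ (add_mem_stepBall hv hw)
        by_cases hbi : b (i, z)
        · rw [discHeight_succ_of_mem hV hbi, discHeight_succ_of_mem hV (hz.1 hbi)]
          exact stepMax_congr hV c key
        · rw [discHeight_succ_of_not_mem hV hbi, discHeight_succ_of_not_mem hV (mt hz.2 hbi)]
          simpa using key 0 h0
    · rw [discHeight_succ_of_not_mem hV hi] at hR
      rw [discHeight_succ_of_not_mem hV (mt (hb _) hi),
        discHeight_succ_of_not_mem hV (mt (hb' _) hi)]
      exact ih R z hR h

lemma discHeight_shift (b : ℕ × G → Prop) (w : G) (i : ℕ) (z : G) :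
    discHeight V hV c (fun p => b (p.1, p.2 + w)) i z = discHeight V hV c b i (z + w) := by
  induction i generalizing z with
  | zero => rfl
  | succ i ih =>
    by_cases h : b (i, z + w)
    · rw [discHeight_succ_of_mem hV h, discHeight_succ_of_mem hV (by exact h)]
      exact stepMax_congr hV c fun v _ => by rw [ih, sub_add_eq_add_sub]
    · rw [discHeight_succ_of_not_mem hV h, discHeight_succ_of_not_mem hV (by exact h), ih]

lemma measurable_stepMax {Ω : Type*} {m : MeasurableSpace Ω} {ξ : Ω → G → ℝ} (x : G)
    (h : ∀ y, Measurable fun ω => ξ ω y) : Measurable fun ω => stepMax V hV c (ξ ω) x := by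
  have : (fun ω => stepMax V hV c (ξ ω) x) = V.sup' hV fun v ω => ξ ω (x - v) + c v := by
    ext ω
    rw [Finset.sup'_apply, stepMax]
  rw [this]
  exact Finset.measurable_sup' hV fun v _ => (h _).add_const _

lemma measurable_discHeight {Ω : Type*} {m : MeasurableSpace Ω} {b : Ω → ℕ × G → Prop} {i : ℕ}
    (h : ∀ j < i, ∀ y, MeasurableSet {ω | b ω (j, y)}) (z : G) :
    Measurable fun ω => discHeight V hV c (b ω) i z := by
  induction i generalizing z with
  | zero => exact measurable_const
  | succ i ih =>
    have ih' := ih fun j hj => h j (hj.trans i.lt_succ_self)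
    exact Measurable.ite (h i i.lt_succ_self z) (measurable_stepMax hV z ih') (ih' z)

end Discrete

/-! ### Chains of arrivals and heights defined by recursion along them -/

section History

variable {G : Type*} [AddCommGroup G] {V : Finset G} {A : G → Set ℝ≥0}

/-- There are `k` arrivals at times before `t`, read backwards in time, the first of them at `z`
and each of the others at a site which influences the preceding one. -/
def HasChain (V : Finset G) (A : G → Set ℝ≥0) : ℕ → ℝ≥0 → G → Prop
  | 0, _, _ => True
  | k + 1, t, z => ∃ τ ∈ A z, τ < t ∧ ∃ v ∈ V, HasChain V A k τ (z - v)

lemma HasChain.mono_time {k : ℕ} {s t : ℝ≥0} {z : G} (h : HasChain V A k s z) (hst : s ≤ t) :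
    HasChain V A k t z := by
  cases k with
  | zero => trivial
  | succ k =>
    obtain ⟨τ, hτ, hs, h⟩ := h
    exact ⟨τ, hτ, hs.trans_le hst, h⟩

lemma HasChain.mono_arrivals {A' : G → Set ℝ≥0} (hA : ∀ z, A z ⊆ A' z) {k : ℕ} {t : ℝ≥0} {z : G}
    (h : HasChain V A k t z) : HasChain V A' k t z := by
  induction k generalizing t z with
  | zero => trivial
  | succ k ih =>
    obtain ⟨τ, hτ, hs, v, hv, h⟩ := h
    exact ⟨τ, hA _ hτ, hs, v, hv, ih h⟩

/-- The strict inequality in `HasChain` leaves room before `t`; a grid finer than this room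
separates successive arrivals of a chain. -/
lemma HasChain.exists_lt {k : ℕ} {t : ℝ≥0} {z : G} (h : HasChain V A k t z) (ht : 0 < t) :
    ∃ s < t, HasChain V A k s z := by
  cases k with
  | zero => exact ⟨0, ht, trivial⟩
  | succ k =>
    obtain ⟨τ, hτ, hs, h⟩ := h
    obtain ⟨s, h1, h2⟩ := exists_between hs
    exact ⟨s, h2, τ, hτ, h1, h⟩

/-- Arrivals are positive and locally finite at each site, and the chains of arrivals that can
influence a given site before a given time have bounded length. -/
structure IsFiniteHistory (V : Finset G) (A : G → Set ℝ≥0) : Prop where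
  finite : ∀ z t, (A z ∩ Set.Iic t).Finite
  zero_notMem : ∀ z, 0 ∉ A z
  exists_not_hasChain : ∀ z t, ∃ k, ¬ HasChain V A k t z

lemma IsFiniteHistory.mono {A' : G → Set ℝ≥0} (h : IsFiniteHistory V A') (hA : ∀ z, A z ⊆ A' z) :
    IsFiniteHistory V A where
  finite z t := (h.finite z t).subset (Set.inter_subset_inter_left _ (hA z))
  zero_notMem z hz := h.zero_notMem z (hA z hz)
  exists_not_hasChain z t :=
    (h.exists_not_hasChain z t).imp fun _ hk hc => hk (hc.mono_arrivals hA)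

lemma IsFiniteHistory.eventually_left (h : IsFiniteHistory V A) (z : G) (t : ℝ≥0) :
    ∀ᶠ s in 𝓝[<] t, ∀ u ∈ Set.Ioo s t, u ∉ A z := by
  have hf : (A z ∩ Set.Iio t).Finite :=
    (h.finite z t).subset (Set.inter_subset_inter_right _ Set.Iio_subset_Iic_self)
  have : ∀ᶠ s in 𝓝[<] t, ∀ u ∈ A z ∩ Set.Iio t, u ≤ s := by
    rw [Filter.eventually_all_finite hf]
    intro u hu
    filter_upwards [Ioo_mem_nhdsLT hu.2] with s hs using hs.1.le
  filter_upwards [this] with s hs u hu hA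
  exact (hs u ⟨hA, hu.2⟩).not_gt hu.1

lemma IsFiniteHistory.exists_left (h : IsFiniteHistory V A) (z : G) {t : ℝ≥0} (ht : 0 < t) :
    ∃ s < t, ∀ v ∈ V, ∀ u ∈ Set.Ioo s t, u ∉ A (z - v) := by
  have : (𝓝[<] t).NeBot := nhdsLT_neBot_of_exists_lt ⟨0, ht⟩
  have h1 : ∀ᶠ s in 𝓝[<] t, ∀ v ∈ V, ∀ u ∈ Set.Ioo s t, u ∉ A (z - v) :=
    (Filter.eventually_all_finset V).2 fun v _ => h.eventually_left (z - v) t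
  obtain ⟨s, hs, hst⟩ := (h1.and self_mem_nhdsWithin).exists
  exact ⟨s, hst, hs⟩

lemma IsFiniteHistory.exists_isGreatest (h : IsFiniteHistory V A) (z : G) (t : ℝ≥0)
    {S : Set ℝ≥0} (hS : S ⊆ A z ∩ Set.Iic t) (hne : S.Nonempty) : ∃ τ, IsGreatest S τ := by
  obtain ⟨τ, hτ⟩ := ((h.finite z t).subset hS).exists_maximal hne
  exact ⟨τ, hτ.1, fun u hu => (le_total u τ).elim id fun h' => hτ.2 hu h'⟩

section Height

variable (hV : V.Nonempty) (c : G → ℝ) (A)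

open Classical in
/-- Heights immediately before a given time, computed from the last `k` generations of arrivals. -/
def leftHeight : ℕ → ℝ≥0 → G → ℝ
  | 0, _, _ => 0
  | k + 1, t, z =>
    if h : ∃ τ, IsGreatest (A z ∩ Set.Iio t) τ then stepMax V hV c (leftHeight k h.choose) z else 0

variable {A}

/-- Without a chain of length `k`, the recursion stops at sites with no earlier arrival before the
default value 0 at depth `k` is reached, so further generations change nothing. -/
lemma leftHeight_eq_of_le {k k' : ℕ} (hk : k ≤ k') {t : ℝ≥0} {z : G} (h : ¬ HasChain V A k t z) :
    leftHeight A hV c k' t z = leftHeight A hV c k t z := by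
  induction k generalizing k' t z with
  | zero => exact (h trivial).elim
  | succ k ih =>
    obtain ⟨k', rfl⟩ : ∃ m, k' = m + 1 := ⟨k' - 1, by omega⟩
    rw [leftHeight, leftHeight]
    split_ifs with hτ
    · have hg := hτ.choose_spec
      refine stepMax_congr hV c fun v hv => ih (by omega) fun hc => h ?_
      exact ⟨_, hg.1.1, hg.1.2, v, hv, hc⟩
    · rfl

/-- The height at `z` immediately before time `t`. -/
def limHeight (hA : IsFiniteHistory V A) (t : ℝ≥0) (z : G) : ℝ :=
  leftHeight A hV c (hA.exists_not_hasChain z t).choose t z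

lemma leftHeight_eq_limHeight (hA : IsFiniteHistory V A) {k : ℕ} {t : ℝ≥0} {z : G}
    (h : ¬ HasChain V A k t z) : leftHeight A hV c k t z = limHeight hV c hA t z := by
  have h' := (hA.exists_not_hasChain z t).choose_spec
  rcases le_total k (hA.exists_not_hasChain z t).choose with hk | hk
  · exact (leftHeight_eq_of_le hV c hk h).symm
  · exact leftHeight_eq_of_le hV c hk h'

open Classical in
/-- The height at `z` after the last of the arrivals in `S`. -/
def heightAfter (hA : IsFiniteHistory V A) (S : Set ℝ≥0) (z : G) : ℝ :=
  if h : ∃ τ, IsGreatest S τ then stepMax V hV c (limHeight hV c hA h.choose) z else 0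

/-- One unfolding of the recursion, with the truncation depth eliminated: this is the evolution rule
in fixed-point form. -/
lemma limHeight_eq_heightAfter (hA : IsFiniteHistory V A) (t : ℝ≥0) (z : G) :
    limHeight hV c hA t z = heightAfter hV c hA (A z ∩ Set.Iio t) z := by
  obtain ⟨k, hk⟩ := hA.exists_not_hasChain z t
  cases k with
  | zero => exact (hk trivial).elim
  | succ k =>
    rw [← leftHeight_eq_limHeight hV c hA hk, leftHeight, heightAfter]
    split_ifs with hτ
    · have hg := hτ.choose_spec
      refine stepMax_congr hV c fun v hv => leftHeight_eq_limHeight hV c hA fun hc => hk ?_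
      exact ⟨_, hg.1.1, hg.1.2, v, hv, hc⟩
    · rfl

lemma heightAfter_of_isGreatest (hA : IsFiniteHistory V A) {S : Set ℝ≥0} {τ : ℝ≥0}
    (h : IsGreatest S τ) (z : G) :
    heightAfter hV c hA S z = stepMax V hV c (limHeight hV c hA τ) z := by
  have h' : ∃ τ, IsGreatest S τ := ⟨τ, h⟩
  rw [heightAfter, dif_pos h', h'.choose_spec.unique h]

end Height

end History

/-! ### Existence, uniqueness and exact discretization of trajectories -/

section Trajectory

variable {d : ℕ} {D : (Fin d → ℤ) → EReal}

/-- The neighbourhood of the displacement function `D`. -/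
def neighbourhood (hD : IsDisplacement D) : Finset (Fin d → ℤ) := hD.finite.toFinset

lemma mem_neighbourhood (hD : IsDisplacement D) {x : Fin d → ℤ} :
    x ∈ neighbourhood hD ↔ D x ≠ ⊥ := by simp [neighbourhood]

lemma zero_mem_neighbourhood (hD : IsDisplacement D) : 0 ∈ neighbourhood hD := by
  rw [mem_neighbourhood, hD.zero]
  exact EReal.coe_ne_bot 1

lemma neighbourhood_nonempty (hD : IsDisplacement D) : (neighbourhood hD).Nonempty :=
  ⟨0, zero_mem_neighbourhood hD⟩

lemma coe_toReal_of_mem_neighbourhood (hD : IsDisplacement D) {x : Fin d → ℤ}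
    (hx : x ∈ neighbourhood hD) : (((D x).toReal : ℝ) : EReal) = D x :=
  EReal.coe_toReal (hD.ne_top x) ((mem_neighbourhood hD).1 hx)

lemma nextHeight_eq_stepMax (hD : IsDisplacement D) (ξ : (Fin d → ℤ) → ℝ) (x : Fin d → ℤ) :
    nextHeight D ξ x = ((stepMax (neighbourhood hD) (neighbourhood_nonempty hD)
      (fun v => (D v).toReal) ξ x : ℝ) : EReal) := by
  apply le_antisymm
  · refine iSup_le fun y => ?_
    by_cases hy : x - y ∈ neighbourhood hD
    · have := le_stepMax (neighbourhood_nonempty hD) (fun v => (D v).toReal) ξ x hy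
      rw [sub_sub_cancel] at this
      rw [← coe_toReal_of_mem_neighbourhood hD hy, ← EReal.coe_add]
      exact EReal.coe_le_coe_iff.2 this
    · rw [mem_neighbourhood, not_not] at hy
      rw [hy, EReal.add_bot]
      exact bot_le
  · obtain ⟨v, hv, h⟩ := Finset.exists_mem_eq_sup' (neighbourhood_nonempty hD)
      (fun v => ξ (x - v) + (D v).toReal)
    rw [stepMax, h, EReal.coe_add, coe_toReal_of_mem_neighbourhood hD hv]
    refine le_iSup_of_le (x - v) ?_
    rw [sub_sub_cancel]

variable {A : (Fin d → ℤ) → Set ℝ≥0} {ξ ξ' : ℝ≥0 → (Fin d → ℤ) → ℝ}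

/-- The left limit in the update rule is that of a function constant on `(s, t)`, since no neighbour
changes there. -/
lemma IsBDTrajectory.eq_stepMax (hD : IsDisplacement D) (hξ : IsBDTrajectory D A ξ) {s t : ℝ≥0} {z : Fin d → ℤ}
    (ht : t ∈ A z) (hst : s < t)
    (h : ∀ v ∈ neighbourhood hD, ∀ u ∈ Set.Ioo s t, u ∉ A (z - v)) :
    ξ t z = stepMax (neighbourhood hD) (neighbourhood_nonempty hD)
      (fun v => (D v).toReal) (ξ s) z := by
  have : (𝓝[<] t).NeBot := nhdsLT_neBot_of_exists_lt ⟨s, hst⟩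
  have h1 : Tendsto (fun s => nextHeight D (ξ s) z) (𝓝[<] t) (𝓝 (nextHeight D (ξ s) z)) := by
    refine tendsto_const_nhds.congr' ?_
    filter_upwards [Ioo_mem_nhdsLT hst] with r hr
    rw [nextHeight_eq_stepMax hD, nextHeight_eq_stepMax hD]
    congr 1
    refine stepMax_congr _ _ fun v hv => ?_
    exact (hξ.const _ _ _ hr.1.le fun u hu => h v hv u ⟨hu.1, hu.2.trans_lt hr.2⟩).symm
  have h2 := tendsto_nhds_unique (hξ.update z t ht) h1
  rw [nextHeight_eq_stepMax hD] at h2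
  exact EReal.coe_injective h2

lemma IsBDTrajectory.eq_of_not_hasChain (hD : IsDisplacement D) (hA : IsFiniteHistory (neighbourhood hD) A)
    (hξ : IsBDTrajectory D A ξ) (hξ' : IsBDTrajectory D A ξ') (k : ℕ) {s t : ℝ≥0} (hst : s < t)
    (z : Fin d → ℤ) (h : ¬ HasChain (neighbourhood hD) A k t z) : ξ s z = ξ' s z := by
  induction k generalizing s t z with
  | zero => exact (h trivial).elim
  | succ k ih =>
    by_cases hne : (A z ∩ Set.Iic s).Nonempty
    · obtain ⟨τ, ⟨hτA, hτs⟩, hτ⟩ := hA.exists_isGreatest z s subset_rfl hne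
      have hc : ∀ u ∈ Set.Ioc τ s, u ∉ A z := fun u hu huA => (hτ ⟨huA, hu.2⟩).not_gt hu.1
      rw [hξ.const z τ s hτs hc, hξ'.const z τ s hτs hc]
      have hτ0 : 0 < τ := pos_iff_ne_zero.2 fun h0 => hA.zero_notMem z (h0 ▸ hτA)
      obtain ⟨r, hr, hrA⟩ := hA.exists_left z hτ0
      rw [hξ.eq_stepMax hD hτA hr hrA, hξ'.eq_stepMax hD hτA hr hrA]
      exact stepMax_congr _ _ fun v hv => ih hr (z - v) fun hc =>
        h ⟨τ, hτA, lt_of_le_of_lt hτs hst, v, hv, hc⟩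
    · have hc : ∀ u ∈ Set.Ioc 0 s, u ∉ A z := fun u hu huA => hne ⟨u, huA, hu.2⟩
      rw [hξ.const z 0 s zero_le hc, hξ'.const z 0 s zero_le hc, hξ.init, hξ'.init]

theorem IsFiniteHistory.exists_trajectory (hD : IsDisplacement D)
    (hA : IsFiniteHistory (neighbourhood hD) A) : ∃ ξ, IsBDTrajectory D A ξ := by
  have hV := neighbourhood_nonempty hD
  let c : (Fin d → ℤ) → ℝ := fun v => (D v).toReal 
  refine ⟨fun t z => heightAfter hV c hA (A z ∩ Set.Iic t) z, fun z => ?_, ?_, ?_⟩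
  · have : ¬ ∃ τ, IsGreatest (A z ∩ Set.Iic 0) τ := by
      rintro ⟨τ, hτ⟩
      exact hA.zero_notMem z (nonpos_iff_eq_zero.1 (Set.mem_Iic.1 hτ.1.2) ▸ hτ.1.1)
    simp only [heightAfter, dif_neg this]
  · intro z s t hst h
    have : A z ∩ Set.Iic t = A z ∩ Set.Iic s := by
      ext u
      refine ⟨fun hu => ⟨hu.1, ?_⟩, fun hu => ⟨hu.1, hu.2.trans hst⟩⟩
      by_contra hus
      exact h u ⟨not_le.1 hus, hu.2⟩ hu.1
    simp only [this]
  · intro z t ht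
    have hg : IsGreatest (A z ∩ Set.Iic t) t := ⟨⟨ht, Set.self_mem_Iic⟩, fun u hu => hu.2⟩
    simp only [heightAfter_of_isGreatest hV c hA hg]
    refine tendsto_const_nhds.congr' ?_
    have h1 : ∀ᶠ s in 𝓝[<] t, ∀ v ∈ neighbourhood hD, ∀ u ∈ Set.Ioo s t, u ∉ A (z - v) :=
      (Filter.eventually_all_finset _).2 fun v _ => hA.eventually_left (z - v) t
    filter_upwards [h1, self_mem_nhdsWithin] with s hs hst
    rw [nextHeight_eq_stepMax hD]
    congr 1
    refine stepMax_congr hV c fun v hv => ?_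
    rw [limHeight_eq_heightAfter]
    congr 1
    ext u
    refine ⟨fun hu => ⟨hu.1, ?_⟩, fun hu => ⟨hu.1, (Set.mem_Iic.1 hu.2).trans_lt (Set.mem_Iio.1 hst)⟩⟩
    by_contra hus
    exact hs v hv u ⟨not_le.1 hus, hu.2⟩ hu.1

theorem IsFiniteHistory.existsUnique_trajectory (hD : IsDisplacement D)
    (hA : IsFiniteHistory (neighbourhood hD) A) : ∃! ξ, IsBDTrajectory D A ξ := by
  obtain ⟨ξ, hξ⟩ := hA.exists_trajectory hD
  refine ⟨ξ, hξ, fun ξ' hξ' => ?_⟩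
  ext t z
  -- Chains consist of arrivals strictly before the given time, so an arrival at `t` itself requires
  -- a later time.
  obtain ⟨k, hk⟩ := hA.exists_not_hasChain z (t + 1)
  rw [hξ'.eq_of_not_hasChain hD hA hξ k (lt_add_one t) z hk]

/-- The cells of the time grid of mesh `δ` that contain an arrival. -/
def gridCells {G : Type*} (A : G → Set ℝ≥0) (δ : ℝ≥0) : ℕ × G → Prop :=
  fun p => ∃ τ ∈ A p.2, p.1 * δ < τ ∧ τ ≤ (p.1 + 1 : ℕ) * δ

/-- If distinct arrival times in `S` are at least `δ` apart, a cell `(iδ, (i+1)δ]` contains at most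
one of them. The neighbours then do not move between `iδ` and the arrival, and the synchronous
update sees the correct heights. Simultaneous arrivals at several sites are harmless, as both rules
use the heights before the update. The chain bound keeps the recursion inside `S`. -/
lemma IsBDTrajectory.discHeight_eq_of_separated (hD : IsDisplacement D)
    (hξ : IsBDTrajectory D A ξ) {S : Set (Fin d → ℤ)} {T δ : ℝ≥0}
    (hsep : ∀ y ∈ S, ∀ y' ∈ S, ∀ τ ∈ A y, ∀ τ' ∈ A y', τ < τ' → τ' ≤ T → τ + δ ≤ τ')
    (i : ℕ) (hi : i * δ ≤ T) (k : ℕ) {s : ℝ≥0} (y : Fin d → ℤ) (hs : i * δ < s)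
    (hk : ¬ HasChain (neighbourhood hD) A k s y)
    (hS : ∀ w ∈ stepBall (neighbourhood hD) k, y - w ∈ S) :
    discHeight (neighbourhood hD) (neighbourhood_nonempty hD) (fun v => (D v).toReal)
      (gridCells A δ) i y = ξ (i * δ) y := by
  have h0 := zero_mem_neighbourhood hD
  induction i generalizing k s y with
  | zero => rw [discHeight_zero, Nat.cast_zero, zero_mul, hξ.init]
  | succ i ih =>
    have hle : (i : ℝ≥0) * δ ≤ (i + 1 : ℕ) * δ := by gcongr; simp
    by_cases hb : gridCells A δ (i, y)
    · rw [discHeight_succ_of_mem _ hb]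
      obtain ⟨τ, hτA, hτ1, hτ2⟩ := hb
      simp only at hτA hτ1 hτ2
      cases k with
      | zero => exact (hk trivial).elim
      | succ k =>
        have hyS : ∀ v ∈ neighbourhood hD, y - v ∈ S := fun v hv => by
          have := hS (v + 0) (add_mem_stepBall hv (zero_mem_stepBall h0 k))
          rwa [add_zero] at this
        have hy : y ∈ S := by simpa using hyS 0 h0
        have hgap : ∀ v ∈ neighbourhood hD, ∀ u ∈ Set.Ioo (i * δ) τ, u ∉ A (y - v) := by
          intro v hv u hu huA
          have h1 := hsep _ (hyS v hv) y hy u huA τ hτA hu.2 (hτ2.trans hi)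
          have h2 : u + δ ≤ i * δ + δ := by
            refine h1.trans (hτ2.trans ?_)
            push_cast
            rw [add_mul, one_mul]
          exact (le_of_add_le_add_right h2).not_gt hu.1
        have hconst : ∀ u ∈ Set.Ioc τ ((i + 1 : ℕ) * δ), u ∉ A y := by
          intro u hu huA
          have h1 := hsep y hy y hy τ hτA u huA hu.1 (hu.2.trans hi)
          have h2 : τ + δ ≤ i * δ + δ := by
            refine h1.trans (hu.2.trans ?_)
            push_cast
            rw [add_mul, one_mul]
          exact (le_of_add_le_add_right h2).not_gt hτ1
        rw [hξ.const y τ _ hτ2 hconst, hξ.eq_stepMax hD hτA hτ1 hgap]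
        refine stepMax_congr _ _ fun v hv => ?_
        refine ih (hle.trans hi) k (y - v) hτ1 ?_ ?_
        · exact fun hc => hk ⟨τ, hτA, hτ2.trans_lt hs, v, hv, hc⟩
        · intro w hw
          rw [sub_sub]
          exact hS _ (add_mem_stepBall hv hw)
    · rw [discHeight_succ_of_not_mem _ hb, ih (hle.trans hi) k y (hle.trans_lt hs) hk hS]
      exact (hξ.const y _ _ hle fun u hu huA => hb ⟨u, huA, hu.1, hu.2⟩).symm

/-- Fine discretizations of time reproduce the heights at a given site up to a given time. -/
theorem IsBDTrajectory.eventually_discHeight_eq (hD : IsDisplacement D)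
    (hA : IsFiniteHistory (neighbourhood hD) A) (hξ : IsBDTrajectory D A ξ) (t : ℝ≥0)
    (z : Fin d → ℤ) :
    ∀ᶠ δ : ℝ≥0 in 𝓝 0, ∀ i : ℕ, i * δ ≤ t →
      discHeight (neighbourhood hD) (neighbourhood_nonempty hD) (fun v => (D v).toReal)
        (gridCells A δ) i z = ξ (i * δ) z := by
  obtain ⟨k, hk⟩ := hA.exists_not_hasChain z (t + 1)
  let F : Set ℝ≥0 := ⋃ w ∈ stepBall (neighbourhood hD) k, A (z - w) ∩ Set.Iic t
  have hF : F.Finite := Set.Finite.biUnion (Finset.finite_toSet _) fun w _ => hA.finite (z - w) t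
  have hgap : ∀ᶠ δ : ℝ≥0 in 𝓝 0, ∀ p ∈ F ×ˢ F, p.1 < p.2 → p.1 + δ ≤ p.2 := by
    rw [Filter.eventually_all_finite (hF.prod hF)]
    rintro ⟨τ, τ'⟩ -
    by_cases h : τ < τ'
    · have : Tendsto (fun δ : ℝ≥0 => τ + δ) (𝓝 0) (𝓝 (τ + 0)) := by
        exact (continuous_const.add continuous_id).tendsto 0
      rw [add_zero] at this
      filter_upwards [this.eventually (gt_mem_nhds h)] with δ hδ _ using hδ.le
    · exact Eventually.of_forall fun δ h' => (h h').elim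
  filter_upwards [hgap] with δ hδ i hi
  refine hξ.discHeight_eq_of_separated hD (S := {y | ∃ w ∈ stepBall (neighbourhood hD) k,
    y = z - w}) (T := t) ?_ i hi k z (lt_of_le_of_lt hi (lt_add_one t)) hk
    fun w hw => ⟨w, hw, rfl⟩
  rintro y ⟨w, hw, rfl⟩ y' ⟨w', hw', rfl⟩ τ hτ τ' hτ' hlt hT
  refine hδ (τ, τ') ⟨?_, ?_⟩ hlt
  · exact Set.mem_biUnion hw ⟨hτ, hlt.le.trans hT⟩
  · exact Set.mem_biUnion hw' ⟨hτ', hT⟩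

end Trajectory

/-- Chains of arrivals are seen by fine discretizations of time. -/
theorem HasChain.eventually_le_discHeight {G : Type*} [AddCommGroup G] {V : Finset G}
    (hV : V.Nonempty) (h0 : 0 ∈ V) {A : G → Set ℝ≥0} (hA : ∀ z, 0 ∉ A z) {k : ℕ} {t : ℝ≥0} {z : G}
    (h : HasChain V A k t z) :
    ∀ᶠ δ : ℝ≥0 in 𝓝 0, ∀ i : ℕ, t ≤ i * δ →
      (k : ℝ) ≤ discHeight V hV (fun _ => 1) (gridCells A δ) i z := by
  induction k generalizing t z with
  | zero =>
    exact Eventually.of_forall fun δ i _ => by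
      simpa using discHeight_nonneg hV (c := fun _ => 1) h0 zero_le_one _ i z
  | succ k ih =>
    obtain ⟨τ, hτA, hτt, v, hv, hc⟩ := h
    have hτ0 : 0 < τ := pos_iff_ne_zero.2 fun h0 => hA z (h0 ▸ hτA)
    obtain ⟨s, hs, hc⟩ := hc.exists_lt hτ0
    have hlim : Tendsto (fun δ : ℝ≥0 => s + δ) (𝓝 0) (𝓝 (s + 0)) :=
      (continuous_const.add continuous_id).tendsto 0
    rw [add_zero] at hlim
    filter_upwards [ih hc, hlim.eventually (gt_mem_nhds hs)] with δ hδ hsδ i hi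
    classical
    have hex : ∃ j : ℕ, τ ≤ j * δ := ⟨i, hτt.le.trans hi⟩
    -- The cell `j` is the one containing `τ`. Since `s + δ < τ`, the rest of the chain lies before
    -- its left end `jδ`, so the induction hypothesis applies there.
    obtain ⟨j, hj⟩ : ∃ j, Nat.find hex = j + 1 := by
      refine Nat.exists_eq_succ_of_ne_zero fun h => ?_
      have := Nat.find_spec hex
      rw [h, Nat.cast_zero, zero_mul] at this
      exact this.not_gt hτ0
    have h1 : τ ≤ (j + 1 : ℕ) * δ := hj ▸ Nat.find_spec hex
    have h2 : j * δ < τ := not_le.1 (Nat.find_min hex (by omega))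
    have h3 : j + 1 ≤ i := hj ▸ Nat.find_min' hex (hτt.le.trans hi)
    have h4 : s ≤ j * δ := by
      have h5 : s + δ ≤ j * δ + δ := by
        refine hsδ.le.trans (h1.trans ?_)
        push_cast
        rw [add_mul, one_mul]
      exact le_of_add_le_add_right h5
    have h6 : gridCells A δ (j, z) := ⟨τ, hτA, h2, h1⟩
    refine le_trans ?_ (discHeight_mono hV (c := fun _ => 1) h0 zero_le_one (gridCells A δ) z h3)
    simp only
    rw [discHeight_succ_of_mem hV h6]
    refine le_trans ?_ (le_stepMax hV _ _ z hv)
    have := hδ j h4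
    push_cast
    linarith

/-! ### Sites near the boundary of a substrate -/

section Geometry

variable {d : ℕ}

/-- A nearest-neighbour path from `z` to `w` that shortens the ℓ¹ distance at each step leaves `Q`
somewhere; the last site before the first exit is a boundary site. -/
lemma exists_boundarySites_of_mem_of_notMem {Q : Finset (Fin d → ℤ)} {w : Fin d → ℤ} (hw : w ∉ Q)
    (n : ℕ) {z : Fin d → ℤ} (hz : z ∈ Q) (hn : ∑ i, |z i - w i| = n) :
    ∃ y ∈ boundarySites Q, ∑ i, |z i - y i| ≤ n := by
  induction n generalizing z with
  | zero =>
    have h0 : ∀ i, z i = w i := fun i => by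
      have := (Finset.sum_eq_zero_iff_of_nonneg fun i _ => abs_nonneg (z i - w i)).1
        (by simpa using hn) i (Finset.mem_univ i)
      exact sub_eq_zero.1 (abs_eq_zero.1 this)
    exact (hw (funext h0 ▸ hz)).elim
  | succ n ih =>
    obtain ⟨i, hi⟩ : ∃ i, z i ≠ w i := by
      by_contra! h
      exact hw (funext h ▸ hz)
    obtain ⟨e, he1, he2⟩ : ∃ e : ℤ, |e| = 1 ∧ |z i + e - w i| = |z i - w i| - 1 := by
      rcases lt_or_gt_of_ne hi with h | h
      · refine ⟨1, by simp, ?_⟩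
        rw [abs_of_nonpos (by omega), abs_of_neg (by omega)]
        ring
      · refine ⟨-1, by simp, ?_⟩
        rw [abs_of_nonneg (by omega), abs_of_pos (by omega)]
        ring
    let z' : Fin d → ℤ := Function.update z i (z i + e)
    have hzz' : ∑ j, |z j - z' j| = 1 := by
      rw [Finset.sum_eq_single i]
      · simp [z', he1]
      · intro j _ hj
        simp [z', hj]
      · simp
    by_cases hz' : z' ∈ Q
    · have hsum : ∑ j, |z' j - w j| = n := by
        have h1 : ∀ j, |z' j - w j| = |z j - w j| - if j = i then 1 else 0 := by
          intro j
          by_cases hj : j = i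
          · subst hj
            simp [z', he2]
          · simp [z', hj]
        rw [Finset.sum_congr rfl fun j _ => h1 j, Finset.sum_sub_distrib, hn]
        simp
      obtain ⟨y, hy, hle⟩ := ih hz' hsum
      refine ⟨y, hy, ?_⟩
      calc ∑ j, |z j - y j| ≤ ∑ j, (|z j - z' j| + |z' j - y j|) :=
            Finset.sum_le_sum fun j _ => abs_sub_le _ _ _
        _ ≤ (n + 1 : ℕ) := by
            rw [Finset.sum_add_distrib, hzz']
            push_cast
            linarith
    · refine ⟨z, ?_, by simp; positivity⟩
      simp only [boundarySites, Finset.mem_filter]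
      exact ⟨hz, z', hz', hzz'⟩

/-- The counted sites lie in translates, centred at boundary sites, of one box depending only on
`W`; `K` is the number of its points. -/
lemma exists_card_filter_le_boundarySites (W : Finset (Fin d → ℤ)) :
    ∃ K : ℕ, ∀ Q : Finset (Fin d → ℤ),
      (Q.filter fun z => ∃ w ∈ W, z - w ∉ Q).card ≤ (boundarySites Q).card * K := by
  classical
  let ρ : ℕ := W.sup fun w => (∑ i, |w i|).toNat
  let B : Finset (Fin d → ℤ) := Finset.Icc (fun _ => -(ρ : ℤ)) (fun _ => (ρ : ℤ))
  refine ⟨B.card, fun Q => ?_⟩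
  rw [← Finset.card_product]
  refine (Finset.card_le_card (t := (boundarySites Q ×ˢ B).image fun p => p.1 + p.2) ?_).trans
    Finset.card_image_le
  intro z hz
  obtain ⟨hzQ, w, hw, hzw⟩ := Finset.mem_filter.1 hz
  have h0 : (0 : ℤ) ≤ ∑ i, |w i| := Finset.sum_nonneg fun i _ => abs_nonneg _
  obtain ⟨y, hy, hle⟩ := exists_boundarySites_of_mem_of_notMem hzw (∑ i, |w i|).toNat hzQ
    (by simp [Int.toNat_of_nonneg h0])
  have hρ : (∑ i, |w i|).toNat ≤ ρ := Finset.le_sup (f := fun w => (∑ i, |w i|).toNat) hw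
  refine Finset.mem_image.2 ⟨(y, z - y), Finset.mem_product.2 ⟨hy, ?_⟩, by simp⟩
  have h1 : ∀ i, |z i - y i| ≤ ρ := fun i =>
    (Finset.single_le_sum (f := fun i => |z i - y i|) (fun i _ => abs_nonneg _)
      (Finset.mem_univ i)).trans (hle.trans (by exact_mod_cast hρ))
  exact Finset.mem_Icc.2 ⟨fun i => (abs_le.1 (h1 i)).1, fun i => (abs_le.1 (h1 i)).2⟩

end Geometry

/-! ### Independent random cells and exponential moments -/

section Cells

variable {G Ω : Type*}

/-- Random cells which are occupied independently of each other, all with the same probability,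
which is at most `p`. -/
structure IsIIDCells [MeasurableSpace Ω] (b : ℕ × G → Ω → Prop) (p : ℝ≥0∞) (P : Measure Ω) : Prop where
  measurable : ∀ q, Measurable (b q)
  indep : iIndepFun b P
  map_eq : ∀ q q', P.map (b q) = P.map (b q')
  prob_le : ∀ q, P {ω | b q ω} ≤ p

/-- The σ-algebra generated by the cells in `S`. -/
@[reducible]
def cellSigma (b : ℕ × G → Ω → Prop) (S : Set (ℕ × G)) : MeasurableSpace Ω :=
  ⨆ q ∈ S, MeasurableSpace.comap (b q) inferInstance

variable {b : ℕ × G → Ω → Prop}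

lemma measurableSet_cellSigma {S : Set (ℕ × G)} {q : ℕ × G} (hq : q ∈ S) :
    MeasurableSet[cellSigma b S] {ω | b q ω} := by
  have h : MeasurableSpace.comap (b q) inferInstance ≤ cellSigma b S :=
    le_iSup₂ (f := fun q (_ : q ∈ S) => MeasurableSpace.comap (b q) inferInstance) q hq
  exact h _ ⟨{True}, trivial, by ext; simp⟩

section
variable [AddCommGroup G] {V : Finset G} (hV : V.Nonempty) {c : G → ℝ}

lemma measurable_discHeight_restrict (U : Set G) {S : Set (ℕ × G)} {i : ℕ}
    (hS : ∀ j < i, ∀ y ∈ U, (j, y) ∈ S) (z : G) :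
    Measurable[cellSigma b S]
      fun ω => discHeight V hV c (restrictCells U fun q => b q ω) i z := by
  refine @measurable_discHeight G _ V hV c Ω (cellSigma b S)
    (fun ω => restrictCells U fun q => b q ω) i (fun j hj y => ?_) z
  by_cases hy : y ∈ U
  · simpa [restrictCells, hy] using measurableSet_cellSigma (hS j hj y hy)
  · simp [restrictCells, hy]

end

variable [MeasurableSpace Ω] {p : ℝ≥0∞} {P : Measure Ω}

namespace IsIIDCells

lemma cellSigma_le (hb : IsIIDCells b p P) (S : Set (ℕ × G)) :
    cellSigma b S ≤ ‹MeasurableSpace Ω› :=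
  iSup₂_le fun q _ => (hb.measurable q).comap_le

lemma indepFun (hb : IsIIDCells b p P) {S T : Set (ℕ × G)} (hST : Disjoint S T)
    {β γ : Type*} [MeasurableSpace β] [MeasurableSpace γ] {f : Ω → β} {g : Ω → γ}
    (hf : Measurable[cellSigma b S] f) (hg : Measurable[cellSigma b T] g) : IndepFun f g P := by
  rw [IndepFun_iff_Indep]
  have h := indep_iSup_of_disjoint (fun q => (hb.measurable q).comap_le)
    ((iIndepFun_iff_iIndep _ b P).1 hb.indep) hST
  exact indep_of_indep_of_le_right (indep_of_indep_of_le_left h hf.comap_le) hg.comap_le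

/-- Both laws are product measures with equal factors. -/
lemma map_shift [AddCommGroup G] [IsProbabilityMeasure P] (hb : IsIIDCells b p P) (w : G) :
    P.map (fun ω q => b (q.1, q.2 + w) ω) = P.map (fun ω q => b q ω) := by
  have hinj : Function.Injective fun q : ℕ × G => (q.1, q.2 + w) := by
    rintro ⟨i, y⟩ ⟨j, z⟩ h
    simpa using h
  rw [(hb.indep.precomp hinj).map_fun_eq_infinitePi_map fun q => hb.measurable _,
    hb.indep.map_fun_eq_infinitePi_map hb.measurable]
  congr 1
  ext1 q
  exact hb.map_eq _ _

variable [AddCommGroup G] {V : Finset G} (hV : V.Nonempty) {c : G → ℝ}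

lemma measurable_discHeight (hb : IsIIDCells b p P) (U : Set G) (i : ℕ) (z : G) :
    Measurable fun ω => discHeight V hV c (restrictCells U fun q => b q ω) i z :=
  (measurable_discHeight_restrict hV U (S := Set.univ) (fun _ _ _ _ => trivial) z).mono
    (hb.cellSigma_le _) le_rfl

/-- Exponential moments of the chain length. -/
lemma lintegral_exp_discHeight_le [IsProbabilityMeasure P] (hb : IsIIDCells b p P) (i : ℕ) (z : G) :
    ∫⁻ ω, ENNReal.ofReal
      (Real.exp (discHeight V hV (fun _ => 1) (restrictCells Set.univ fun q => b q ω) i z)) ∂P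
      ≤ (1 + p * (ENNReal.ofReal (Real.exp 1) * V.card)) ^ i := by
  induction i generalizing z with
  | zero => simp [discHeight_zero]
  | succ i ih =>
    set L : ℕ → G → Ω → ℝ := fun i z ω =>
      discHeight V hV (fun _ => 1) (restrictCells Set.univ fun q => b q ω) i z with hL
    have hLm : ∀ i z, Measurable (L i z) := fun i z => hb.measurable_discHeight hV _ i z
    let X : G → Ω → ℝ≥0∞ := fun z ω => ENNReal.ofReal (Real.exp (L i z ω))
    have hXm : ∀ z, Measurable (X z) := fun z =>
      ENNReal.measurable_ofReal.comp (Real.measurable_exp.comp (hLm i z))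
    let I : Ω → ℝ≥0∞ := {ω | b (i, z) ω}.indicator 1
    have hIm : Measurable I := measurable_one.indicator (measurableSet_setOfPred.2 (hb.measurable _))
    let Y : Ω → ℝ≥0∞ := fun ω => ∑ v ∈ V, X (z - v) ω
    have hYm : Measurable Y := Finset.measurable_fun_sum _ fun v _ => hXm _
    -- An occupied cell replaces the exponential by `e` times a maximum over the neighbours, which
    -- is at most the sum `Y`.
    have hpt : ∀ ω, ENNReal.ofReal (Real.exp (L (i + 1) z ω))
        ≤ X z ω + ENNReal.ofReal (Real.exp 1) * (I * Y) ω := by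
      intro ω
      by_cases h : b (i, z) ω
      · have h' : restrictCells Set.univ (fun q => b q ω) (i, z) := ⟨trivial, h⟩
        refine le_trans ?_ le_add_self
        obtain ⟨v, hv, hve⟩ := Finset.exists_mem_eq_sup' hV fun v => L i (z - v) ω + 1
        have h1 : L (i + 1) z ω = L i (z - v) ω + 1 := by
          rw [← hve]
          exact discHeight_succ_of_mem hV h'
        have h2 : I ω = 1 := Set.indicator_of_mem (by exact h) _
        rw [h1, Real.exp_add, mul_comm, ENNReal.ofReal_mul (Real.exp_nonneg 1), Pi.mul_apply, h2,
          one_mul]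
        gcongr
        exact Finset.single_le_sum (f := fun v => X (z - v) ω) (fun _ _ => zero_le) hv
      · have h' : ¬ restrictCells Set.univ (fun q => b q ω) (i, z) := fun h' => h h'.2
        refine le_trans (le_of_eq ?_) le_self_add
        simp only [hL, X]
        rw [discHeight_succ_of_not_mem hV h']
    have hYle : ∫⁻ ω, Y ω ∂P ≤ V.card * (1 + p * (ENNReal.ofReal (Real.exp 1) * V.card)) ^ i := by
      rw [lintegral_finsetSum _ fun v _ => hXm _, ← nsmul_eq_mul]
      exact Finset.sum_le_card_nsmul _ _ _ fun v _ => ih _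
    -- The indicator concerns a cell of step `i`, while `Y` uses only cells of earlier steps.
    have hind : IndepFun I Y P := by
      refine hb.indepFun (S := {(i, z)}) (T := {q | q.1 < i}) ?_ ?_ ?_
      · simp
      · exact (@measurable_const _ _ _ (cellSigma b {(i, z)}) (1 : ℝ≥0∞)).indicator
          (measurableSet_cellSigma (Set.mem_singleton _))
      · have : ∀ y, Measurable[cellSigma b {q | q.1 < i}] (X y) := fun y =>
          ENNReal.measurable_ofReal.comp (Real.measurable_exp.comp
            (measurable_discHeight_restrict hV Set.univ (fun j hj y _ => hj) y))
        exact @Finset.measurable_fun_sum _ _ _ _ _ _ (cellSigma b {q | q.1 < i}) _ V fun v _ => this _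
    calc ∫⁻ ω, ENNReal.ofReal (Real.exp (L (i + 1) z ω)) ∂P
        ≤ ∫⁻ ω, X z ω + ENNReal.ofReal (Real.exp 1) * (I * Y) ω ∂P := lintegral_mono hpt
      _ = ∫⁻ ω, X z ω ∂P + ENNReal.ofReal (Real.exp 1) * ((∫⁻ ω, I ω ∂P) * ∫⁻ ω, Y ω ∂P) := by
          rw [lintegral_add_left (hXm z), lintegral_const_mul _ (hIm.mul hYm),
            lintegral_mul_eq_lintegral_mul_lintegral_of_indepFun hIm hYm hind]
      _ ≤ (1 + p * (ENNReal.ofReal (Real.exp 1) * V.card)) ^ i + ENNReal.ofReal (Real.exp 1) *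
          (p * (V.card * (1 + p * (ENNReal.ofReal (Real.exp 1) * V.card)) ^ i)) := by
          have hI : ∫⁻ ω, I ω ∂P ≤ p := by
            rw [lintegral_indicator_one (measurableSet_setOfPred.2 (hb.measurable _))]
            exact hb.prob_le _
          gcongr
          exact ih z
      _ = (1 + p * (ENNReal.ofReal (Real.exp 1) * V.card)) ^ (i + 1) := by ring

end IsIIDCells

end Cells

/-! ### Domination and localization of functions of the height -/

section LLN

variable {G Ω : Type*} [AddCommGroup G]

/-- `f` is a function of the height whose square grows at most exponentially, for displacements `c`
on `V` bounded by `C`. -/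
structure IsAdmissible (V : Finset G) (c : G → ℝ) (f : ℝ → ℝ) (C K : ℝ) : Prop where
  zero_mem : 0 ∈ V
  zero_nonneg : 0 ≤ c 0
  pos : 0 < C
  le : ∀ v ∈ V, c v ≤ C
  measurable : Measurable f
  nonneg : 0 ≤ K
  sq_le : ∀ x, 0 ≤ x → f x ^ 2 ≤ K * Real.exp (x / (2 * C))

/-- The height in discrete time for random cells and the substrate `U`. -/
def cellHeight (V : Finset G) (hV : V.Nonempty) (c : G → ℝ) (b : ℕ × G → Ω → Prop) (U : Set G)
    (M : ℕ) (z : G) (ω : Ω) : ℝ :=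
  discHeight V hV c (restrictCells U fun q => b q ω) M z

/-- The sites that are reached from `z` by at most `R` steps against displacements in `V`. -/
def siteBall [DecidableEq G] (V : Finset G) (R : ℕ) (z : G) : Set G :=
  {y | ∃ w ∈ stepBall V R, y = z - w}

variable {V : Finset G} (hV : V.Nonempty) {c : G → ℝ} {f : ℝ → ℝ} {C K : ℝ}
  {b : ℕ × G → Ω → Prop} {M : ℕ}

namespace IsAdmissible

/-- Since the height is at most `C` times the chain length L, the growth condition gives exp(L/2).
The unused half of the exponent pays for the tail L > R below. -/
lemma sq_cellHeight_le (hf : IsAdmissible V c f C K) (U : Set G) (z : G) (ω : Ω) :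
    f (cellHeight V hV c b U M z ω) ^ 2
      ≤ K * Real.exp (cellHeight V hV (fun _ => 1) b Set.univ M z ω / 2) := by
  have h1 : cellHeight V hV c b U M z ω ≤ C * cellHeight V hV (fun _ => 1) b Set.univ M z ω :=
    discHeight_le_mul hV hf.zero_mem hf.pos.le hf.le (fun q hq => ⟨trivial, hq.2⟩) M z
  have h2 : 0 ≤ cellHeight V hV c b U M z ω :=
    discHeight_nonneg hV hf.zero_mem hf.zero_nonneg _ M z
  refine (hf.sq_le _ h2).trans ?_
  have h3 := hf.pos
  have h4 := hf.nonneg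
  gcongr K * Real.exp ?_
  rw [div_le_div_iff₀ (by positivity) (by positivity)]
  linarith

lemma sq_cellHeight_le_exp (hf : IsAdmissible V c f C K) (U : Set G) (z : G) (ω : Ω) :
    f (cellHeight V hV c b U M z ω) ^ 2
      ≤ K * Real.exp (cellHeight V hV (fun _ => 1) b Set.univ M z ω) := by
  have h2 : 0 ≤ cellHeight V hV (fun _ => 1) b Set.univ M z ω :=
    discHeight_nonneg hV hf.zero_mem zero_le_one _ M z
  refine (hf.sq_cellHeight_le hV U z ω).trans ?_
  have := hf.nonneg
  gcongr
  linarith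

lemma sq_sub_cellHeight_le (hf : IsAdmissible V c f C K) (U U' : Set G) (z : G) (ω : Ω) :
    (f (cellHeight V hV c b U M z ω) - f (cellHeight V hV c b U' M z ω)) ^ 2
      ≤ 4 * K * Real.exp (cellHeight V hV (fun _ => 1) b Set.univ M z ω) := by
  have h1 := hf.sq_cellHeight_le_exp hV (b := b) (M := M) U z ω
  have h2 := hf.sq_cellHeight_le_exp hV (b := b) (M := M) U' z ω
  nlinarith [sq_nonneg (f (cellHeight V hV c b U M z ω) + f (cellHeight V hV c b U' M z ω))]

/-- If L ≤ R the two heights coincide. If L > R, then exp(L/2) ≤ exp(-R/2) exp(L). -/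
lemma sq_sub_cellHeight_siteBall_le [DecidableEq G] (hf : IsAdmissible V c f C K) (R : ℕ) (z : G)
    {U : Set G} (hU : siteBall V R z ⊆ U) (ω : Ω) :
    (f (cellHeight V hV c b U M z ω) - f (cellHeight V hV c b (siteBall V R z) M z ω)) ^ 2
      ≤ 4 * K * Real.exp (-(R / 2)) *
        Real.exp (cellHeight V hV (fun _ => 1) b Set.univ M z ω) := by
  have hK := hf.nonneg
  by_cases hR : cellHeight V hV (fun _ => 1) b Set.univ M z ω ≤ R
  · have : cellHeight V hV c b U M z ω = cellHeight V hV c b (siteBall V R z) M z ω := by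
      refine discHeight_congr_of_le hV hf.zero_mem (fun q hq => ⟨trivial, hq.2⟩)
        (fun q hq => ⟨trivial, hq.2⟩) M R z hR fun j w hw => ?_
      have h1 : z - w ∈ siteBall V R z := ⟨w, hw, rfl⟩
      simp [restrictCells, h1, hU h1]
    rw [this]
    rw [sub_self, zero_pow two_ne_zero]
    positivity
  · have h1 := hf.sq_cellHeight_le hV (b := b) (M := M) U z ω
    have h2 := hf.sq_cellHeight_le hV (b := b) (M := M) (siteBall V R z) z ω
    have h3 : Real.exp (cellHeight V hV (fun _ => 1) b Set.univ M z ω / 2)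
        ≤ Real.exp (-(R / 2)) * Real.exp (cellHeight V hV (fun _ => 1) b Set.univ M z ω) := by
      rw [← Real.exp_add]
      gcongr
      linarith
    have h4 := mul_le_mul_of_nonneg_left h3 hK
    nlinarith [sq_nonneg (f (cellHeight V hV c b U M z ω)
      + f (cellHeight V hV c b (siteBall V R z) M z ω))]

variable [MeasurableSpace Ω] {p : ℝ≥0∞} {P : Measure Ω} {Γ : ℝ}

lemma measurable_cellHeight (hb : IsIIDCells b p P) (U : Set G) (z : G) :
    Measurable (cellHeight V hV c b U M z) := hb.measurable_discHeight hV U M z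

variable [IsProbabilityMeasure P]

lemma integrable_exp_cellHeight (hb : IsIIDCells b p P)
    (hΓ : (1 + p * (ENNReal.ofReal (Real.exp 1) * V.card)) ^ M ≤ ENNReal.ofReal Γ) (z : G) :
    Integrable (fun ω => Real.exp (cellHeight V hV (fun _ => 1) b Set.univ M z ω)) P := by
  refine (lintegral_ofReal_ne_top_iff_integrable ?_ ?_).1 ?_
  · exact (Real.measurable_exp.comp (measurable_cellHeight hV hb _ z)).aestronglyMeasurable
  · exact Eventually.of_forall fun ω => (Real.exp_pos _).le
  · exact (((hb.lintegral_exp_discHeight_le hV M z).trans hΓ).trans_lt ENNReal.ofReal_lt_top).ne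

lemma integral_exp_cellHeight_le (hb : IsIIDCells b p P) (hΓ0 : 0 ≤ Γ)
    (hΓ : (1 + p * (ENNReal.ofReal (Real.exp 1) * V.card)) ^ M ≤ ENNReal.ofReal Γ) (z : G) :
    ∫ ω, Real.exp (cellHeight V hV (fun _ => 1) b Set.univ M z ω) ∂P ≤ Γ := by
  rw [← ENNReal.ofReal_le_ofReal_iff hΓ0, ofReal_integral_eq_lintegral_ofReal
    (integrable_exp_cellHeight hV hb hΓ z) (Eventually.of_forall fun ω => (Real.exp_pos _).le)]
  exact (hb.lintegral_exp_discHeight_le hV M z).trans hΓ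

lemma memLp_cellHeight (hf : IsAdmissible V c f C K) (hb : IsIIDCells b p P)
    (hΓ : (1 + p * (ENNReal.ofReal (Real.exp 1) * V.card)) ^ M ≤ ENNReal.ofReal Γ)
    (U : Set G) (z : G) : MemLp (fun ω => f (cellHeight V hV c b U M z ω)) 2 P := by
  have hm : Measurable fun ω => f (cellHeight V hV c b U M z ω) :=
    hf.measurable.comp (measurable_cellHeight hV hb U z)
  rw [memLp_two_iff_integrable_sq hm.aestronglyMeasurable]
  refine ((integrable_exp_cellHeight hV hb hΓ z).const_mul K).mono'
    (hm.pow_const 2).aestronglyMeasurable (Eventually.of_forall fun ω => ?_)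
  rw [Real.norm_of_nonneg (sq_nonneg _)]
  exact hf.sq_cellHeight_le_exp hV U z ω

lemma integral_sq_cellHeight_le (hf : IsAdmissible V c f C K) (hb : IsIIDCells b p P) (hΓ0 : 0 ≤ Γ)
    (hΓ : (1 + p * (ENNReal.ofReal (Real.exp 1) * V.card)) ^ M ≤ ENNReal.ofReal Γ)
    (U : Set G) (z : G) : ∫ ω, f (cellHeight V hV c b U M z ω) ^ 2 ∂P ≤ K * Γ := by
  calc ∫ ω, f (cellHeight V hV c b U M z ω) ^ 2 ∂P
      ≤ ∫ ω, K * Real.exp (cellHeight V hV (fun _ => 1) b Set.univ M z ω) ∂P :=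
        integral_mono (hf.memLp_cellHeight hV hb hΓ U z).integrable_sq
          ((integrable_exp_cellHeight hV hb hΓ z).const_mul K)
          fun ω => hf.sq_cellHeight_le_exp hV U z ω
    _ ≤ K * Γ := by
        rw [integral_const_mul]
        exact mul_le_mul_of_nonneg_left (integral_exp_cellHeight_le hV hb hΓ0 hΓ z) hf.nonneg

lemma integral_sq_sub_le (hf : IsAdmissible V c f C K) (hb : IsIIDCells b p P) (hΓ0 : 0 ≤ Γ)
    (hΓ : (1 + p * (ENNReal.ofReal (Real.exp 1) * V.card)) ^ M ≤ ENNReal.ofReal Γ)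
    (U U' : Set G) (z : G) {a : ℝ} (ha : 0 ≤ a)
    (h : ∀ ω, (f (cellHeight V hV c b U M z ω) - f (cellHeight V hV c b U' M z ω)) ^ 2
      ≤ a * Real.exp (cellHeight V hV (fun _ => 1) b Set.univ M z ω)) :
    ∫ ω, (f (cellHeight V hV c b U M z ω) - f (cellHeight V hV c b U' M z ω)) ^ 2 ∂P
      ≤ a * Γ := by
  refine (integral_mono
    ((hf.memLp_cellHeight hV hb hΓ U z).sub (hf.memLp_cellHeight hV hb hΓ U' z)).integrable_sq
    ((integrable_exp_cellHeight hV hb hΓ z).const_mul a) h).trans ?_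
  rw [integral_const_mul]
  exact mul_le_mul_of_nonneg_left (integral_exp_cellHeight_le hV hb hΓ0 hΓ z) ha

/-- The local height at `z` is a fixed function of the environment shifted by `z`, whose law does
not depend on `z`. -/
lemma integral_siteBall_eq [DecidableEq G] (hf : IsAdmissible V c f C K) (hb : IsIIDCells b p P)
    (R : ℕ) (z : G) :
    ∫ ω, f (cellHeight V hV c b (siteBall V R z) M z ω) ∂P
      = ∫ ω, f (cellHeight V hV c b (siteBall V R 0) M 0 ω) ∂P := by
  let g : (ℕ × G → Prop) → ℝ := fun β =>
    f (discHeight V hV c (restrictCells (siteBall V R 0) β) M 0)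
  have hg : Measurable g := by
    refine hf.measurable.comp ?_
    refine _root_.measurable_discHeight (b := fun β => restrictCells (siteBall V R 0) β) hV
      (fun j _ y => ?_) 0
    by_cases hy : y ∈ siteBall V R 0
    · simpa [restrictCells, hy] using measurableSet_setOfPred.2 (measurable_pi_apply (j, y))
    · simp [restrictCells, hy]
  have h1 : ∀ ω, f (cellHeight V hV c b (siteBall V R z) M z ω)
      = g fun q => b (q.1, q.2 + z) ω := by
    intro ω
    simp only [g, cellHeight]
    congr 1
    have := discHeight_shift hV (c := c) (restrictCells (siteBall V R z) fun q => b q ω) z M 0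
    rw [zero_add] at this
    rw [← this]
    congr 1
    ext ⟨j, y⟩
    have : y + z ∈ siteBall V R z ↔ y ∈ siteBall V R 0 := by
      simp only [siteBall, Set.mem_ofPred_eq]
      refine exists_congr fun w => and_congr_right fun _ => ?_
      rw [eq_sub_iff_add_eq, eq_sub_iff_add_eq, add_right_comm, add_eq_right]
    simp [restrictCells, this]
  have h2 : ∀ ω, f (cellHeight V hV c b (siteBall V R 0) M 0 ω) = g fun q => b q ω := fun ω => rfl
  simp_rw [h1, h2]
  have hm1 : Measurable fun ω (q : ℕ × G) => b q ω := measurable_pi_lambda _ hb.measurable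
  have hm2 : Measurable fun ω (q : ℕ × G) => b (q.1, q.2 + z) ω :=
    measurable_pi_lambda _ fun q => hb.measurable _
  rw [← integral_map (f := g) hm1.aemeasurable hg.aestronglyMeasurable, ← hb.map_shift z,
    integral_map hm2.aemeasurable hg.aestronglyMeasurable]

end IsAdmissible

end LLN

/-! ### Averages of variables with finite range of dependence -/

section Average

variable {Ω : Type*} [MeasurableSpace Ω] {P : Measure Ω}

lemma sq_inv_card_mul_sum_le {ι : Type*} (Q : Finset ι) (e : ι → ℝ) :
    ((Q.card : ℝ)⁻¹ * ∑ z ∈ Q, e z) ^ 2 ≤ (Q.card : ℝ)⁻¹ * ∑ z ∈ Q, e z ^ 2 := by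
  rcases Q.eq_empty_or_nonempty with rfl | hQ
  · simp
  have hc : (0 : ℝ) < Q.card := by exact_mod_cast hQ.card_pos
  have h := sq_sum_le_card_mul_sum_sq (s := Q) (f := e)
  rw [mul_pow]
  calc ((Q.card : ℝ)⁻¹) ^ 2 * (∑ z ∈ Q, e z) ^ 2
      ≤ ((Q.card : ℝ)⁻¹) ^ 2 * (Q.card * ∑ z ∈ Q, e z ^ 2) := by gcongr
    _ = (Q.card : ℝ)⁻¹ * ∑ z ∈ Q, e z ^ 2 := by field_simp

lemma sq_integral_le_integral_sq [IsProbabilityMeasure P] {X : Ω → ℝ} (hX : MemLp X 2 P) :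
    (∫ ω, X ω ∂P) ^ 2 ≤ ∫ ω, X ω ^ 2 ∂P := by
  have h := variance_eq_sub hX
  have h0 := variance_nonneg X P
  simp only [Pi.pow_apply] at h
  linarith

/-- The mean of centred variables of bounded variance with a finite range of dependence is
small in `L²`. -/
lemma integral_sq_average_le {G : Type*} [AddCommGroup G] [DecidableEq G] {Y : G → Ω → ℝ} {B : ℝ}
    (hB : 0 ≤ B) (hY : ∀ z, MemLp (Y z) 2 P) (hYB : ∀ z, ∫ ω, Y z ω ^ 2 ∂P ≤ B) (E : Finset G)
    (hcov : ∀ z z', z' - z ∉ E → ∫ ω, Y z ω * Y z' ω ∂P = 0) (Q : Finset G) :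
    ∫ ω, ((Q.card : ℝ)⁻¹ * ∑ z ∈ Q, Y z ω) ^ 2 ∂P ≤ B * E.card / Q.card := by
  have hint : ∀ z z', Integrable (fun ω => Y z ω * Y z' ω) P := fun z z' =>
    (hY z).integrable_mul (hY z')
  have hexp : ∀ ω, ((Q.card : ℝ)⁻¹ * ∑ z ∈ Q, Y z ω) ^ 2
      = ((Q.card : ℝ)⁻¹) ^ 2 * ∑ z ∈ Q, ∑ z' ∈ Q, Y z ω * Y z' ω := by
    intro ω
    rw [mul_pow, sq (∑ z ∈ Q, Y z ω), Finset.sum_mul_sum]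
  simp_rw [hexp]
  rw [integral_const_mul, integral_finsetSum _ fun z _ => integrable_finsetSum _ fun z' _ => hint z z']
  have hterm : ∀ z z', ∫ ω, Y z ω * Y z' ω ∂P ≤ if z' - z ∈ E then B else 0 := by
    intro z z'
    split_ifs with h
    · calc ∫ ω, Y z ω * Y z' ω ∂P ≤ ∫ ω, (Y z ω ^ 2 + Y z' ω ^ 2) / 2 ∂P := by
            refine integral_mono (hint z z')
              (((hY z).integrable_sq.add (hY z').integrable_sq).div_const 2) fun ω => ?_
            have := two_mul_le_add_sq (Y z ω) (Y z' ω)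
            simp only
            linarith
        _ ≤ B := by
            rw [integral_div, integral_add (hY z).integrable_sq (hY z').integrable_sq]
            linarith [hYB z, hYB z']
    · exact (hcov z z' h).le
  have hrow : ∀ z ∈ Q, ∫ ω, ∑ z' ∈ Q, Y z ω * Y z' ω ∂P ≤ B * E.card := by
    intro z _
    rw [integral_finsetSum _ fun z' _ => hint z z']
    refine (Finset.sum_le_sum fun z' _ => hterm z z').trans ?_
    rw [← Finset.sum_filter, Finset.sum_const, nsmul_eq_mul, mul_comm]
    refine mul_le_mul_of_nonneg_left (Nat.cast_le.2 ?_) hB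
    -- For fixed `z`, at most `E.card` sites `z'` contribute, so the double sum has order `Q.card`
    -- rather than its square.
    exact Finset.card_le_card_of_injOn (t := E) (fun z' => z' - z)
      (fun z' hz' => (Finset.mem_filter.1 hz').2) fun x _ y _ h => sub_left_injective h
  rcases Q.eq_empty_or_nonempty with rfl | hQ
  · simp
  have hc : (0 : ℝ) < Q.card := by exact_mod_cast hQ.card_pos
  calc ((Q.card : ℝ)⁻¹) ^ 2 * ∑ z ∈ Q, ∫ ω, ∑ z' ∈ Q, Y z ω * Y z' ω ∂P
      ≤ ((Q.card : ℝ)⁻¹) ^ 2 * (Q.card • (B * E.card)) := by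
        gcongr
        exact Finset.sum_le_card_nsmul _ _ _ hrow
    _ = B * E.card / Q.card := by
        rw [nsmul_eq_mul]
        field_simp

end Average

/-! ### Quantitative law of large numbers in discrete time -/

section LLN

variable {G Ω : Type*} [AddCommGroup G] [DecidableEq G] {V : Finset G} (hV : V.Nonempty)
  {c : G → ℝ} {f : ℝ → ℝ} {C K : ℝ} {b : ℕ × G → Ω → Prop} {M : ℕ}
  [MeasurableSpace Ω] {p : ℝ≥0∞} {P : Measure Ω} {Γ : ℝ}

namespace IsAdmissible

/-- The condition on `z' - z` says that the balls about the two sites are disjoint, so the heights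
use disjoint sets of cells. -/
lemma indepFun_siteBall (hf : IsAdmissible V c f C K) (hb : IsIIDCells b p P) (R : ℕ) {z z' : G}
    (h : z' - z ∉ stepBall V R - stepBall V R) :
    IndepFun (fun ω => f (cellHeight V hV c b (siteBall V R z) M z ω))
      (fun ω => f (cellHeight V hV c b (siteBall V R z') M z' ω)) P := by
  refine hb.indepFun (S := {q | q.2 ∈ siteBall V R z}) (T := {q | q.2 ∈ siteBall V R z'}) ?_
    (hf.measurable.comp (measurable_discHeight_restrict hV _ (fun _ _ _ hy => hy) z))
    (hf.measurable.comp (measurable_discHeight_restrict hV _ (fun _ _ _ hy => hy) z'))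
  rw [Set.disjoint_left]
  rintro q ⟨w, hw, hq⟩ ⟨w', hw', hq'⟩
  refine h (Finset.mem_sub.2 ⟨w', hw', w, hw, ?_⟩)
  rw [hq, sub_eq_sub_iff_add_eq_add] at hq'
  rw [sub_eq_sub_iff_add_eq_add, add_comm, hq']

variable [IsProbabilityMeasure P]

lemma integral_sq_average_siteBall_le (hf : IsAdmissible V c f C K) (hb : IsIIDCells b p P)
    (hΓ0 : 0 ≤ Γ) (hΓ : (1 + p * (ENNReal.ofReal (Real.exp 1) * V.card)) ^ M ≤ ENNReal.ofReal Γ)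
    (R : ℕ) (Q : Finset G) :
    ∫ ω, ((Q.card : ℝ)⁻¹ * ∑ z ∈ Q, (f (cellHeight V hV c b (siteBall V R z) M z ω)
      - ∫ ω, f (cellHeight V hV c b (siteBall V R 0) M 0 ω) ∂P)) ^ 2 ∂P
      ≤ K * Γ * (stepBall V R - stepBall V R).card / Q.card := by
  have hL := fun z => hf.memLp_cellHeight hV hb hΓ (siteBall V R z) z
  have hm := fun z => hf.integral_siteBall_eq hV (M := M) hb R z
  refine integral_sq_average_le
    (Y := fun z ω => f (cellHeight V hV c b (siteBall V R z) M z ω)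
      - ∫ ω, f (cellHeight V hV c b (siteBall V R 0) M 0 ω) ∂P)
    (mul_nonneg hf.nonneg hΓ0) (fun z => (hL z).sub (memLp_const _))
    (fun z => ?_) _ (fun z z' h => ?_) Q
  · have h1 := variance_eq_integral (hL z).aestronglyMeasurable.aemeasurable
    simp only [hm z] at h1
    rw [← h1]
    refine (variance_le_expectation_sq (hL z).aestronglyMeasurable).trans ?_
    exact hf.integral_sq_cellHeight_le hV hb hΓ0 hΓ _ z
  · set m := ∫ ω, f (cellHeight V hV c b (siteBall V R 0) M 0 ω) ∂P
    have h1 : IndepFun (fun ω => f (cellHeight V hV c b (siteBall V R z) M z ω) - m)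
        (fun ω => f (cellHeight V hV c b (siteBall V R z') M z' ω) - m) P :=
      (hf.indepFun_siteBall hV hb R h).comp (φ := fun x => x - m) (ψ := fun x => x - m)
        (measurable_id.sub_const m) (measurable_id.sub_const m)
    rw [h1.integral_fun_mul_eq_mul_integral
      ((hL z).sub (memLp_const m)).aestronglyMeasurable
      ((hL z').sub (memLp_const m)).aestronglyMeasurable,
      integral_sub ((hL z).integrable one_le_two) (integrable_const m), hm z]
    simp

/-- Sites whose ball lies in `Q` have the exponentially small localization error; the others have
only the crude bound, and enter through their proportion. -/
lemma integral_sq_average_sub_le (hf : IsAdmissible V c f C K) (hb : IsIIDCells b p P)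
    (hΓ0 : 0 ≤ Γ) (hΓ : (1 + p * (ENNReal.ofReal (Real.exp 1) * V.card)) ^ M ≤ ENNReal.ofReal Γ)
    (R : ℕ) (Q : Finset G) :
    ∫ ω, ((Q.card : ℝ)⁻¹ * ∑ z ∈ Q, (f (cellHeight V hV c b Q M z ω)
      - f (cellHeight V hV c b (siteBall V R z) M z ω))) ^ 2 ∂P
      ≤ 4 * K * Γ * (Real.exp (-(R / 2)) +
        (Q.filter fun z => ∃ w ∈ stepBall V R, z - w ∉ Q).card / Q.card) := by
  have hK := hf.nonneg
  have hL : ∀ z, MemLp (fun ω => f (cellHeight V hV c b Q M z ω)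
      - f (cellHeight V hV c b (siteBall V R z) M z ω)) 2 P := fun z =>
    (hf.memLp_cellHeight hV hb hΓ Q z).sub (hf.memLp_cellHeight hV hb hΓ (siteBall V R z) z)
  have hterm : ∀ z ∈ Q, ∫ ω, (f (cellHeight V hV c b Q M z ω)
      - f (cellHeight V hV c b (siteBall V R z) M z ω)) ^ 2 ∂P
      ≤ 4 * K * Γ * (Real.exp (-(R / 2)) + if ∃ w ∈ stepBall V R, z - w ∉ Q then 1 else 0) := by
    intro z _
    split_ifs with h
    · have h1 := hf.integral_sq_sub_le hV hb hΓ0 hΓ Q (siteBall V R z) z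
        (a := 4 * K) (by positivity) fun ω => hf.sq_sub_cellHeight_le hV _ _ z ω
      refine h1.trans (le_mul_of_one_le_right (by positivity) ?_)
      linarith [Real.exp_pos (-((R : ℝ) / 2))]
    · have hU : siteBall V R z ⊆ Q := by
        rintro y ⟨w, hw, rfl⟩
        by_contra hy
        exact h ⟨w, hw, hy⟩
      have h1 := hf.integral_sq_sub_le hV hb hΓ0 hΓ Q (siteBall V R z) z
        (a := 4 * K * Real.exp (-(R / 2))) (by positivity)
        fun ω => hf.sq_sub_cellHeight_siteBall_le hV R z hU ω
      rw [add_zero]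
      linarith
  calc ∫ ω, ((Q.card : ℝ)⁻¹ * ∑ z ∈ Q, (f (cellHeight V hV c b Q M z ω)
      - f (cellHeight V hV c b (siteBall V R z) M z ω))) ^ 2 ∂P
      ≤ ∫ ω, (Q.card : ℝ)⁻¹ * ∑ z ∈ Q, (f (cellHeight V hV c b Q M z ω)
      - f (cellHeight V hV c b (siteBall V R z) M z ω)) ^ 2 ∂P := by
        refine integral_mono ?_ ?_ fun ω => sq_inv_card_mul_sum_le Q _
        · exact ((memLp_finsetSum Q fun z _ => hL z).const_mul _).integrable_sq
        · exact (integrable_finsetSum Q fun z _ => (hL z).integrable_sq).const_mul _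
    _ ≤ (Q.card : ℝ)⁻¹ * ∑ z ∈ Q, 4 * K * Γ *
        (Real.exp (-(R / 2)) + if ∃ w ∈ stepBall V R, z - w ∉ Q then 1 else 0) := by
        rw [integral_const_mul, integral_finsetSum _ fun z _ => (hL z).integrable_sq]
        gcongr with z hz
        exact hterm z hz
    _ ≤ _ := by
        rw [← Finset.mul_sum, Finset.sum_add_distrib, Finset.sum_const, ← Finset.sum_filter,
          Finset.sum_const, nsmul_eq_mul, nsmul_eq_mul, mul_one]
        rcases Q.eq_empty_or_nonempty with rfl | hQ
        · simp
          positivity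
        have hc : (0 : ℝ) < Q.card := by exact_mod_cast hQ.card_pos
        apply le_of_eq
        field_simp

/-- Quantitative law of large numbers for the heights in discrete time, uniform in the mesh. -/
theorem integral_sq_average_sub_integral_le (hf : IsAdmissible V c f C K) (hb : IsIIDCells b p P)
    (hΓ0 : 0 ≤ Γ) (hΓ : (1 + p * (ENNReal.ofReal (Real.exp 1) * V.card)) ^ M ≤ ENNReal.ofReal Γ)
    (R : ℕ) {Q : Finset G} (hQ : Q.Nonempty) :
    ∫ ω, ((Q.card : ℝ)⁻¹ * ∑ z ∈ Q, f (cellHeight V hV c b Q M z ω)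
      - ∫ ω, f (cellHeight V hV c b Set.univ M 0 ω) ∂P) ^ 2 ∂P
      ≤ K * Γ * (24 * Real.exp (-(R / 2))
        + 12 * ((Q.filter fun z => ∃ w ∈ stepBall V R, z - w ∉ Q).card / Q.card)
        + 3 * ((stepBall V R - stepBall V R).card / Q.card)) := by
  have hK := hf.nonneg
  have hc : (0 : ℝ) < Q.card := by exact_mod_cast hQ.card_pos
  set m := ∫ ω, f (cellHeight V hV c b Set.univ M 0 ω) ∂P with hm
  set m' := ∫ ω, f (cellHeight V hV c b (siteBall V R 0) M 0 ω) ∂P with hm'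
  have hLu := hf.memLp_cellHeight hV hb hΓ Set.univ 0
  have hL0 := hf.memLp_cellHeight hV hb hΓ (siteBall V R 0) 0
  have hL := fun z => hf.memLp_cellHeight hV hb hΓ (siteBall V R z) z
  have hLQ := fun z => hf.memLp_cellHeight hV hb hΓ Q z
  set T1 : Ω → ℝ := fun ω => (Q.card : ℝ)⁻¹ * ∑ z ∈ Q, (f (cellHeight V hV c b Q M z ω)
      - f (cellHeight V hV c b (siteBall V R z) M z ω)) with hT1
  set T2 : Ω → ℝ := fun ω => (Q.card : ℝ)⁻¹ * ∑ z ∈ Q,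
      (f (cellHeight V hV c b (siteBall V R z) M z ω) - m') with hT2
  have h1 : ∫ ω, T1 ω ^ 2 ∂P ≤ _ := hf.integral_sq_average_sub_le hV hb hΓ0 hΓ R Q
  have h2 : ∫ ω, T2 ω ^ 2 ∂P ≤ _ := hf.integral_sq_average_siteBall_le hV hb hΓ0 hΓ R Q
  have hI1 : MemLp T1 2 P := (memLp_finsetSum Q fun z _ => (hLQ z).sub (hL z)).const_mul _
  have hI2 : MemLp T2 2 P :=
    (memLp_finsetSum Q fun z _ => (hL z).sub (memLp_const m')).const_mul _
  have hJ1 : Integrable (fun ω => 3 * T1 ω ^ 2) P := hI1.integrable_sq.const_mul 3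
  have hJ2 : Integrable (fun ω => 3 * T2 ω ^ 2) P := hI2.integrable_sq.const_mul 3
  have hJ : Integrable (fun ω => 3 * T1 ω ^ 2 + 3 * T2 ω ^ 2) P := hJ1.add hJ2
  have h3 : (m' - m) ^ 2 ≤ 4 * K * Real.exp (-(R / 2)) * Γ := by
    have h4 : (m - m') ^ 2 ≤ ∫ ω, (f (cellHeight V hV c b Set.univ M 0 ω)
        - f (cellHeight V hV c b (siteBall V R 0) M 0 ω)) ^ 2 ∂P := by
      rw [hm, hm', ← integral_sub (hLu.integrable one_le_two) (hL0.integrable one_le_two)]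
      exact sq_integral_le_integral_sq (hLu.sub hL0)
    have h5 := hf.integral_sq_sub_le hV hb hΓ0 hΓ Set.univ (siteBall V R 0) 0
      (a := 4 * K * Real.exp (-(R / 2))) (by positivity)
      fun ω => hf.sq_sub_cellHeight_siteBall_le hV R 0 (Set.subset_univ _) ω
    have h6 := h4.trans h5
    nlinarith
  -- Localization error, centred local average and difference of the means. With (x + y + w)² ≤ 3(x²
  -- + y² + w²), the first and the last each contribute 12 to the constant 24.
  have hdec : ∀ ω, (Q.card : ℝ)⁻¹ * ∑ z ∈ Q, f (cellHeight V hV c b Q M z ω) - m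
      = T1 ω + T2 ω + (m' - m) := by
    intro ω
    simp only [hT1, hT2, Finset.sum_sub_distrib, Finset.sum_const, nsmul_eq_mul]
    field_simp
    ring
  calc ∫ ω, ((Q.card : ℝ)⁻¹ * ∑ z ∈ Q, f (cellHeight V hV c b Q M z ω) - m) ^ 2 ∂P
      ≤ ∫ ω, (3 * T1 ω ^ 2 + 3 * T2 ω ^ 2 + 3 * (m' - m) ^ 2) ∂P := by
        refine integral_mono ?_ ?_ fun ω => ?_
        · exact ((((memLp_finsetSum Q fun z _ => hLQ z).const_mul _).sub
            (memLp_const m))).integrable_sq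
        · exact hJ.add (integrable_const _)
        · simp only [hdec ω]
          nlinarith [sq_nonneg (T1 ω - T2 ω), sq_nonneg (T1 ω - (m' - m)),
            sq_nonneg (T2 ω - (m' - m))]
    _ = 3 * ∫ ω, T1 ω ^ 2 ∂P + 3 * ∫ ω, T2 ω ^ 2 ∂P + 3 * (m' - m) ^ 2 := by
        rw [integral_add hJ (integrable_const _), integral_add hJ1 hJ2, integral_const_mul,
          integral_const_mul]
        simp
    _ ≤ _ := by
        rw [mul_div_assoc] at h2
        linarith

end IsAdmissible

end LLN

/-! ### Poisson arrivals as random cells, and passage to fine meshes -/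

section Arrivals

variable {d : ℕ} {Ω : Type*}

/-- A cell of the time grid of mesh `δ` is occupied if the counting process increases. -/
def arrivalCells (N : (Fin d → ℤ) → ℝ≥0 → Ω → ℕ) (δ : ℝ≥0) (q : ℕ × (Fin d → ℤ)) (ω : Ω) : Prop :=
  N q.2 ((q.1 + 1 : ℕ) * δ) ω - N q.2 (q.1 * δ) ω ≠ 0

lemma poissonMeasure_ne_zero_le (r : ℝ≥0) : poissonMeasure r {n | n ≠ 0} ≤ r := by
  have h : {n : ℕ | n ≠ 0} = {0}ᶜ := by ext; simp
  rw [h, prob_compl_eq_one_sub (measurableSet_singleton 0), poissonMeasure_singleton]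
  simp only [pow_zero, Nat.factorial_zero, Nat.cast_one, mul_one, div_one]
  rw [← ENNReal.ofReal_one, ← ENNReal.ofReal_sub _ (Real.exp_pos _).le, ← ENNReal.ofReal_coe_nnreal]
  apply ENNReal.ofReal_le_ofReal
  linarith [Real.add_one_le_exp (-(r : ℝ))]

variable {N : (Fin d → ℤ) → ℝ≥0 → Ω → ℕ}

lemma gridCells_arrivalTimes_iff {ω : Ω} (hmono : ∀ z, Monotone fun t => N z t ω)
    (hcont : ∀ z t, ContinuousWithinAt (fun s => N z s ω) (Set.Ici t) t) (δ : ℝ≥0)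
    (q : ℕ × (Fin d → ℤ)) :
    gridCells (arrivalTimes N ω) δ q ↔ arrivalCells N δ q ω := by
  obtain ⟨i, z⟩ := q
  simp only [gridCells, arrivalCells]
  set a : ℝ≥0 := i * δ
  set e : ℝ≥0 := (i + 1 : ℕ) * δ
  constructor
  · rintro ⟨τ, hτ, h1, h2⟩
    have h3 := hτ.2 a h1
    have h4 : N z τ ω ≤ N z e ω := hmono z h2
    omega
  · intro h
    have hlt : N z a ω < N z e ω := by omega
    -- The arrival is the first time at which the counter exceeds its value at the left end of the
    -- cell; right continuity makes the infimum attained.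
    let S : Set ℝ≥0 := {u | N z a ω < N z u ω}
    have hS : S.Nonempty := ⟨e, hlt⟩
    have hτS : sInf S ∈ S := by
      have hev : ∀ᶠ s in 𝓝[≥] (sInf S), N z s ω = N z (sInf S) ω := by
        have := hcont z (sInf S)
        rw [ContinuousWithinAt, nhds_discrete, tendsto_pure] at this
        exact this
      obtain ⟨u, hu, hev⟩ := (mem_nhdsGE_iff_exists_Ico_subset).1 hev
      obtain ⟨s, hs, hsu⟩ := exists_lt_of_csInf_lt hS hu
      have h5 : N z s ω = N z (sInf S) ω := hev ⟨csInf_le (OrderBot.bddBelow S) hs, hsu⟩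
      change N z a ω < N z (sInf S) ω
      rw [← h5]
      exact hs
    have hmin : ∀ s < sInf S, N z s ω < N z (sInf S) ω := by
      intro s hs
      have h6 : s ∉ S := fun h => (csInf_le (OrderBot.bddBelow S) h).not_gt hs
      exact (not_lt.1 h6).trans_lt hτS
    have ha : a < sInf S := by
      by_contra h7
      exact (hmono z (not_lt.1 h7)).not_gt hτS
    exact ⟨sInf S, ⟨pos_of_gt ha, hmin⟩, ha, csInf_le (OrderBot.bddBelow S) hlt⟩

lemma finite_arrivalTimes {ω : Ω} {z : Fin d → ℤ} (hmono : Monotone fun t => N z t ω) (t : ℝ≥0) :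
    (arrivalTimes N ω z ∩ Set.Iic t).Finite := by
  refine Set.Finite.of_finite_image (f := fun s => N z s ω)
    ((Set.finite_Iic (N z t ω)).subset ?_) ?_
  · rintro _ ⟨s, hs, rfl⟩
    exact hmono hs.2
  · intro s hs s' hs' h
    by_contra hne
    rcases lt_or_gt_of_ne hne with hlt | hlt
    · exact (hs'.1.2 s hlt).ne h
    · exact (hs.1.2 s' hlt).ne h.symm

variable [MeasurableSpace Ω] {P : Measure Ω}

/-- Independence between sites and independence of increments at each site combine to independence
over all cells; the occupation probability is 1 - exp(-δ) ≤ δ. -/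
lemma isIIDCells_arrivalCells [IsProbabilityMeasure P] (hN : IsPoissonArrivals N P) (δ : ℝ≥0) :
    IsIIDCells (arrivalCells N δ) δ P := by
  let X : (Fin d → ℤ) → ℕ → Ω → ℕ := fun z i ω => N z ((i + 1 : ℕ) * δ) ω - N z (i * δ) ω
  have hX : ∀ z i, Measurable (X z i) := fun z i =>
    ((hN.poisson z).measurable _).sub ((hN.poisson z).measurable _)
  have hne : Measurable fun n : ℕ => n ≠ 0 := Measurable.of_discrete
  have hlaw : ∀ z i, HasLaw (X z i) (poissonMeasure δ) P := by
    intro z i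
    have h := (hN.poisson z).law (i * δ) ((i + 1 : ℕ) * δ) (by gcongr; simp)
    have h' : ((i + 1 : ℕ) : ℝ≥0) * δ - i * δ = δ := by
      push_cast
      rw [add_mul, one_mul, add_tsub_cancel_left]
    rwa [h'] at h
  have hmap : ∀ q, P.map (arrivalCells N δ q) = (poissonMeasure δ).map fun n : ℕ => n ≠ 0 := by
    intro q
    rw [← (hlaw q.2 q.1).map_eq, Measure.map_map hne (hX _ _)]
    rfl
  refine ⟨fun q => hne.comp (hX q.2 q.1), ?_, fun q q' => by rw [hmap, hmap], fun q => ?_⟩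
  · have h1 : iIndepFun (fun z ω i => X z i ω) P :=
      hN.indep.comp (fun _ path i => path ((i + 1 : ℕ) * δ) - path (i * δ)) fun _ =>
        measurable_pi_lambda _ fun i => (measurable_pi_apply _).sub (measurable_pi_apply _)
    have h2 : ∀ z, iIndepFun (X z) P := fun z =>
      (hN.poisson z).indepIncrements.nat (t := fun i : ℕ => i * δ) fun i j hij => by
        simp only
        gcongr
    have h3 := (iIndepFun_uncurry' hX h1 h2).precomp Prod.swap_injective
    exact h3.comp (fun _ n => n ≠ 0) fun _ => hne
  · have h1 : P {ω | arrivalCells N δ q ω} = poissonMeasure δ {n | n ≠ 0} := by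
      rw [← (hlaw q.2 q.1).map_eq, Measure.map_apply (hX _ _) (MeasurableSet.of_discrete)]
      rfl
    rw [h1]
    exact poissonMeasure_ne_zero_le δ

lemma ae_gridCells_arrivalTimes_iff (hN : IsPoissonArrivals N P) :
    ∀ᵐ ω ∂P, ∀ δ q, gridCells (arrivalTimes N ω) δ q ↔ arrivalCells N δ q ω := by
  filter_upwards [ae_all_iff.2 fun z => (hN.poisson z).monotone,
    ae_all_iff.2 fun z => (hN.poisson z).rightCont] with ω h1 h2 δ q
  exact gridCells_arrivalTimes_iff h1 h2 δ q

lemma restrictCells_univ {G : Type*} (b : ℕ × G → Prop) : restrictCells Set.univ b = b := by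
  ext q
  simp [restrictCells]

lemma gridCells_restrictArrivals (A : (Fin d → ℤ) → Set ℝ≥0) (Q : Finset (Fin d → ℤ)) (δ : ℝ≥0) :
    gridCells (restrictArrivals A Q) δ = restrictCells Q (gridCells A δ) := by
  ext q
  simp only [gridCells, restrictCells, restrictArrivals, Finset.mem_coe]
  constructor
  · rintro ⟨τ, hτ, h⟩
    exact ⟨hτ.1, τ, hτ.2, h⟩
  · rintro ⟨hq, τ, hτ, h⟩
    exact ⟨τ, ⟨hq, hτ⟩, h⟩

/-- The mesh of the division of `[0, t]` into `M + 1` parts. -/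
def mesh (t : ℝ≥0) (M : ℕ) : ℝ≥0 := t / (M + 1 : ℕ)

lemma mul_mesh (t : ℝ≥0) (M : ℕ) : ((M + 1 : ℕ) : ℝ≥0) * mesh t M = t := by
  rw [mesh, mul_div_cancel₀]
  positivity

lemma tendsto_mesh (t : ℝ≥0) : Tendsto (mesh t) atTop (𝓝 0) := by
  have h := ((tendsto_inv_atTop_nhds_zero_nat (𝕜 := ℝ≥0)).comp
    (tendsto_add_atTop_nat 1)).const_mul t
  rw [mul_zero] at h
  exact h

/-- The bound for the exponential moments of the chain length up to time `t`. -/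
def expBound (V : Finset (Fin d → ℤ)) (t : ℝ≥0) : ℝ := Real.exp (t * (Real.exp 1 * V.card))

lemma one_add_mesh_pow_le (V : Finset (Fin d → ℤ)) (t : ℝ≥0) (M : ℕ) :
    (1 + (mesh t M : ℝ≥0∞) * (ENNReal.ofReal (Real.exp 1) * V.card)) ^ (M + 1)
      ≤ ENNReal.ofReal (expBound V t) := by
  have h1 : (1 + (mesh t M : ℝ≥0∞) * (ENNReal.ofReal (Real.exp 1) * V.card))
      = ENNReal.ofReal (1 + mesh t M * (Real.exp 1 * V.card)) := by
    rw [ENNReal.ofReal_add zero_le_one (by positivity), ENNReal.ofReal_one,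
      ENNReal.ofReal_mul (by positivity), ENNReal.ofReal_mul (by positivity),
      ENNReal.ofReal_coe_nnreal, ENNReal.ofReal_natCast]
  have h2 : (t : ℝ) = ((M + 1 : ℕ) : ℝ) * mesh t M := by
    have h := congrArg NNReal.toReal (mul_mesh t M)
    rw [NNReal.coe_mul, NNReal.coe_natCast] at h
    exact h.symm
  rw [h1, ← ENNReal.ofReal_pow (by positivity)]
  apply ENNReal.ofReal_le_ofReal
  rw [expBound, h2, mul_assoc, Real.exp_nat_mul]
  gcongr
  linarith [Real.add_one_le_exp ((mesh t M : ℝ) * (Real.exp 1 * V.card))]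

/-- Arbitrarily long chains of arrivals would force the discrete chain lengths to infinity as the
mesh shrinks. By Fatou's lemma and the uniform exponential bound this has probability 0. -/
lemma ae_exists_not_hasChain [IsProbabilityMeasure P] (hN : IsPoissonArrivals N P)
    {V : Finset (Fin d → ℤ)} (hV : V.Nonempty) (h0 : 0 ∈ V) (t : ℝ≥0) (z : Fin d → ℤ) :
    ∀ᵐ ω ∂P, ∃ k, ¬ HasChain V (arrivalTimes N ω) k t z := by
  let X : ℕ → Ω → ℝ≥0∞ := fun M ω => ENNReal.ofReal (Real.exp
    (cellHeight V hV (fun _ => 1) (arrivalCells N (mesh t M)) Set.univ (M + 1) z ω))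
  have hX : ∀ M, Measurable (X M) := fun M => ENNReal.measurable_ofReal.comp
    (Real.measurable_exp.comp ((isIIDCells_arrivalCells hN _).measurable_discHeight hV _ _ _))
  have hfin : ∫⁻ ω, liminf (fun M => X M ω) atTop ∂P ≠ ∞ := by
    refine ((lintegral_liminf_le hX).trans ?_).trans_lt
      (ENNReal.ofReal_lt_top (r := expBound V t)) |>.ne
    refine (liminf_le_liminf (Eventually.of_forall fun M => ?_)).trans
      (liminf_const (f := atTop (α := ℕ)) (ENNReal.ofReal (expBound V t))).le
    exact ((isIIDCells_arrivalCells hN _).lintegral_exp_discHeight_le hV _ z).trans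
      (one_add_mesh_pow_le V t M)
  filter_upwards [ae_gridCells_arrivalTimes_iff hN,
    ae_lt_top (Measurable.liminf hX) hfin] with ω hω hlt
  by_contra! hchain
  refine hlt.ne (ENNReal.eq_top_of_forall_nnreal_le fun r => ?_)
  obtain ⟨k, hk⟩ := exists_nat_ge (r : ℝ)
  have hev := (hchain k).eventually_le_discHeight hV h0 (fun z hz => hz.1.false)
  refine le_liminf_of_le (by isBoundedDefault) ?_
  filter_upwards [(tendsto_mesh t).eventually hev] with M hM
  have h1 := hM (M + 1) (mul_mesh t M).ge
  have h2 : gridCells (arrivalTimes N ω) (mesh t M)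
      = restrictCells Set.univ fun q => arrivalCells N (mesh t M) q ω := by
    rw [restrictCells_univ]
    ext q
    exact hω _ q
  rw [h2] at h1
  rw [← ENNReal.ofReal_coe_nnreal]
  apply ENNReal.ofReal_le_ofReal
  have h3 := Real.add_one_le_exp
    (cellHeight V hV (fun _ => 1) (arrivalCells N (mesh t M)) Set.univ (M + 1) z ω)
  simp only [cellHeight] at h3 ⊢
  linarith

theorem ae_isFiniteHistory [IsProbabilityMeasure P] (hN : IsPoissonArrivals N P)
    {V : Finset (Fin d → ℤ)} (h0 : 0 ∈ V) :
    ∀ᵐ ω ∂P, IsFiniteHistory V (arrivalTimes N ω) := by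
  filter_upwards [ae_all_iff.2 fun z => (hN.poisson z).monotone,
    ae_all_iff.2 fun T : ℕ => ae_all_iff.2 fun z => ae_exists_not_hasChain hN ⟨0, h0⟩ h0 T z]
    with ω h1 h2
  refine ⟨fun z t => finite_arrivalTimes (h1 z) t, fun z hz => hz.1.false, fun z t => ?_⟩
  -- A chain before `t` is a chain before any later time, so integer times suffice and only
  -- countably many null sets are removed.
  obtain ⟨T, hT⟩ := exists_nat_ge t
  obtain ⟨k, hk⟩ := h2 T z
  exact ⟨k, fun h => hk (h.mono_time hT)⟩

lemma IsFiniteHistory.restrictArrivals {V : Finset (Fin d → ℤ)} {A : (Fin d → ℤ) → Set ℝ≥0}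
    (hA : IsFiniteHistory V A) (Q : Finset (Fin d → ℤ)) :
    IsFiniteHistory V (restrictArrivals A Q) := hA.mono fun _ _ h => h.2

lemma isBDTrajectory_bdHeight {D : (Fin d → ℤ) → EReal} {A : (Fin d → ℤ) → Set ℝ≥0}
    (h : ∃ ξ, IsBDTrajectory D A ξ) : IsBDTrajectory D A (bdHeight D A) := by
  rw [bdHeight, dif_pos h]
  exact h.choose_spec

lemma IsFiniteHistory.eventually_discHeight_mesh_eq {D : (Fin d → ℤ) → EReal}
    (hD : IsDisplacement D) {A : (Fin d → ℤ) → Set ℝ≥0}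
    (hA : IsFiniteHistory (neighbourhood hD) A) (t : ℝ≥0) (z : Fin d → ℤ) :
    ∀ᶠ M in atTop, discHeight (neighbourhood hD) (neighbourhood_nonempty hD)
      (fun v => (D v).toReal) (gridCells A (mesh t M)) (M + 1) z = bdHeight D A t z := by
  have h := (isBDTrajectory_bdHeight (hA.exists_trajectory hD)).eventually_discHeight_eq hD hA t z
  filter_upwards [(tendsto_mesh t).eventually h] with M hM
  have h1 := hM (M + 1) (mul_mesh t M).le
  rwa [mul_mesh] at h1

theorem ae_eventually_cellHeight_eq [IsProbabilityMeasure P] (hN : IsPoissonArrivals N P)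
    {D : (Fin d → ℤ) → EReal} (hD : IsDisplacement D) (t : ℝ≥0) :
    ∀ᵐ ω ∂P, ∀ z, ∀ᶠ M in atTop,
      cellHeight (neighbourhood hD) (neighbourhood_nonempty hD) (fun v => (D v).toReal)
        (arrivalCells N (mesh t M)) Set.univ (M + 1) z ω = bdHeight D (arrivalTimes N ω) t z := by
  filter_upwards [ae_gridCells_arrivalTimes_iff hN,
    ae_isFiniteHistory hN (zero_mem_neighbourhood hD)] with ω h1 h2 z
  filter_upwards [h2.eventually_discHeight_mesh_eq hD t z] with M hM
  rw [← hM, cellHeight, restrictCells_univ]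
  congr 1
  ext q
  exact (h1 _ q).symm

theorem ae_eventually_cellHeight_restrict_eq [IsProbabilityMeasure P]
    (hN : IsPoissonArrivals N P) {D : (Fin d → ℤ) → EReal} (hD : IsDisplacement D) (t : ℝ≥0)
    (Q : Finset (Fin d → ℤ)) :
    ∀ᵐ ω ∂P, ∀ z, ∀ᶠ M in atTop,
      cellHeight (neighbourhood hD) (neighbourhood_nonempty hD) (fun v => (D v).toReal)
        (arrivalCells N (mesh t M)) Q (M + 1) z ω
        = bdHeight D (restrictArrivals (arrivalTimes N ω) Q) t z := by
  filter_upwards [ae_gridCells_arrivalTimes_iff hN,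
    ae_isFiniteHistory hN (zero_mem_neighbourhood hD)] with ω h1 h2 z
  filter_upwards [(h2.restrictArrivals Q).eventually_discHeight_mesh_eq hD t z] with M hM
  rw [← hM, cellHeight, gridCells_restrictArrivals]
  congr 2
  ext q
  exact (h1 _ q).symm

end Arrivals

/-! ### Limits of variables with bounded second moments -/

section Convergence

variable {Ω : Type*} [MeasurableSpace Ω] {P : Measure Ω} {X : ℕ → Ω → ℝ} {Y : Ω → ℝ} {B : ℝ}

lemma memLp_two_and_integral_sq_le_of_tendsto (hX : ∀ M, MemLp (X M) 2 P)
    (hB : ∀ M, ∫ ω, X M ω ^ 2 ∂P ≤ B)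
    (hlim : ∀ᵐ ω ∂P, Tendsto (fun M => X M ω) atTop (𝓝 (Y ω))) :
    MemLp Y 2 P ∧ ∫ ω, Y ω ^ 2 ∂P ≤ B := by
  have hB0 : 0 ≤ B := (integral_nonneg fun ω => sq_nonneg (X 0 ω)).trans (hB 0)
  have hm : AEStronglyMeasurable Y P :=
    aestronglyMeasurable_of_tendsto_ae atTop (fun M => (hX M).aestronglyMeasurable) hlim
  have hle : ∫⁻ ω, ENNReal.ofReal (Y ω ^ 2) ∂P ≤ ENNReal.ofReal B := by
    calc ∫⁻ ω, ENNReal.ofReal (Y ω ^ 2) ∂P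
        = ∫⁻ ω, liminf (fun M => ENNReal.ofReal (X M ω ^ 2)) atTop ∂P := by
          refine lintegral_congr_ae ?_
          filter_upwards [hlim] with ω hω
          exact ((ENNReal.continuous_ofReal.tendsto _).comp (hω.pow 2)).liminf_eq.symm
      _ ≤ liminf (fun M => ∫⁻ ω, ENNReal.ofReal (X M ω ^ 2) ∂P) atTop :=
          lintegral_liminf_le' fun M =>
            ((hX M).aestronglyMeasurable.aemeasurable.pow_const 2).ennreal_ofReal
      _ ≤ liminf (fun _ : ℕ => ENNReal.ofReal B) atTop := by
          refine liminf_le_liminf (Eventually.of_forall fun M => ?_)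
          rw [← ofReal_integral_eq_lintegral_ofReal (hX M).integrable_sq
            (Eventually.of_forall fun ω => sq_nonneg _)]
          exact ENNReal.ofReal_le_ofReal (hB M)
      _ = ENNReal.ofReal B := liminf_const _
  have hint : Integrable (fun ω => Y ω ^ 2) P :=
    (lintegral_ofReal_ne_top_iff_integrable (hm.pow 2)
      (Eventually.of_forall fun ω => sq_nonneg _)).1 (hle.trans_lt ENNReal.ofReal_lt_top).ne
  refine ⟨(memLp_two_iff_integrable_sq hm).2 hint, ?_⟩
  rwa [← ENNReal.ofReal_le_ofReal_iff hB0, ofReal_integral_eq_lintegral_ofReal hint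
    (Eventually.of_forall fun ω => sq_nonneg _)]

/-- Bounded second moments give uniform integrability: the differences truncated at `A` converge by
dominated convergence, and the excess is at most 4B/A in mean. -/
lemma tendsto_integral_of_tendsto_ae_of_integral_sq_le [IsProbabilityMeasure P]
    (hX : ∀ M, MemLp (X M) 2 P) (hB : ∀ M, ∫ ω, X M ω ^ 2 ∂P ≤ B)
    (hlim : ∀ᵐ ω ∂P, Tendsto (fun M => X M ω) atTop (𝓝 (Y ω))) :
    Tendsto (fun M => ∫ ω, X M ω ∂P) atTop (𝓝 (∫ ω, Y ω ∂P)) := by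
  have hB0 : 0 ≤ B := (integral_nonneg fun ω => sq_nonneg (X 0 ω)).trans (hB 0)
  obtain ⟨hY, hYB⟩ := memLp_two_and_integral_sq_le_of_tendsto hX hB hlim
  let Z : ℕ → Ω → ℝ := fun M ω => |X M ω - Y ω|
  have hZ : ∀ M, MemLp (Z M) 2 P := fun M => ((hX M).sub hY).abs
  have hZB : ∀ M, ∫ ω, Z M ω ^ 2 ∂P ≤ 4 * B := by
    intro M
    calc ∫ ω, Z M ω ^ 2 ∂P ≤ ∫ ω, (2 * X M ω ^ 2 + 2 * Y ω ^ 2) ∂P := by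
          refine integral_mono (hZ M).integrable_sq
            (((hX M).integrable_sq.const_mul 2).add (hY.integrable_sq.const_mul 2)) fun ω => ?_
          simp only [Z, sq_abs]
          nlinarith [sq_nonneg (X M ω + Y ω)]
      _ ≤ 4 * B := by
          rw [integral_add ((hX M).integrable_sq.const_mul 2) (hY.integrable_sq.const_mul 2),
            integral_const_mul, integral_const_mul]
          linarith [hB M]
  have hmin : ∀ A : ℝ, 0 ≤ A → Tendsto (fun M => ∫ ω, min (Z M ω) A ∂P) atTop (𝓝 0) := by
    intro A hA
    have h := tendsto_integral_of_dominated_convergence (F := fun M ω => min (Z M ω) A)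
      (f := fun _ => (0 : ℝ)) (μ := P) (fun _ => A)
      (fun M => (hZ M).aestronglyMeasurable.inf aestronglyMeasurable_const) (integrable_const A)
      (fun M => Eventually.of_forall fun ω => ?_) ?_
    · simpa using h
    · rw [Real.norm_of_nonneg (le_min (abs_nonneg _) hA)]
      exact min_le_right _ _
    · filter_upwards [hlim] with ω hω
      have h1 : Tendsto (fun M => Z M ω) atTop (𝓝 |Y ω - Y ω|) :=
        (hω.sub tendsto_const_nhds).abs
      have h2 := h1.min (tendsto_const_nhds (x := A))
      simpa [hA] using h2
  rw [Metric.tendsto_atTop']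
  intro ε hε
  -- The summand 1 keeps `A` positive when `B = 0`.
  obtain ⟨A, hA0, hA⟩ : ∃ A : ℝ, 0 < A ∧ 4 * B / A < ε / 2 := by
    refine ⟨8 * B / ε + 1, by positivity, ?_⟩
    rw [div_lt_iff₀ (by positivity)]
    field_simp
    linarith
  obtain ⟨M0, hM0⟩ := (eventually_atTop.1 ((hmin A hA0.le).eventually (gt_mem_nhds (half_pos hε))))
  refine ⟨M0, fun M hM => ?_⟩
  have hminI : Integrable (fun ω => min (Z M ω) A) P :=
    ((hZ M).integrable one_le_two).inf (integrable_const A)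
  rw [Real.dist_eq, ← integral_sub ((hX M).integrable one_le_two) (hY.integrable one_le_two)]
  calc |∫ ω, (X M ω - Y ω) ∂P| ≤ ∫ ω, Z M ω ∂P := abs_integral_le_integral_abs
    _ ≤ ∫ ω, (min (Z M ω) A + Z M ω ^ 2 / A) ∂P := by
        refine integral_mono ((hZ M).integrable one_le_two)
          (hminI.add ((hZ M).integrable_sq.div_const A)) fun ω => ?_
        have h0 : 0 ≤ Z M ω := abs_nonneg _
        simp only
        rcases le_total (Z M ω) A with h | h
        · rw [min_eq_left h]
          have : 0 ≤ Z M ω ^ 2 / A := by positivity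
          linarith
        · rw [min_eq_right h]
          have : Z M ω ≤ Z M ω ^ 2 / A := by
            rw [le_div_iff₀ hA0]
            nlinarith
          linarith
    _ = ∫ ω, min (Z M ω) A ∂P + (∫ ω, Z M ω ^ 2 ∂P) / A := by
        rw [integral_add hminI ((hZ M).integrable_sq.div_const A), integral_div]
    _ ≤ ∫ ω, min (Z M ω) A ∂P + 4 * B / A := by
        gcongr
        exact hZB M
    _ < ε := by linarith [hM0 M hM.le]

lemma tendsto_eLpNorm_one_of_tendsto_integral_abs (hX : ∀ n, Integrable (X n) P)
    (h : Tendsto (fun n => ∫ ω, |X n ω| ∂P) atTop (𝓝 0)) :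
    Tendsto (fun n => eLpNorm (X n) 1 P) atTop (𝓝 0) := by
  have h1 : ∀ n, eLpNorm (X n) 1 P = ENNReal.ofReal (∫ ω, |X n ω| ∂P) := by
    intro n
    rw [eLpNorm_one_eq_lintegral_enorm, ← ofReal_integral_norm_eq_lintegral_enorm (hX n)]
    rfl
  simp_rw [h1]
  simpa [Function.comp_def] using (ENNReal.continuous_ofReal.tendsto 0).comp h

lemma tendsto_integral_abs_of_tendsto_integral_sq [IsProbabilityMeasure P]
    (hX : ∀ n, MemLp (X n) 2 P) (h : Tendsto (fun n => ∫ ω, X n ω ^ 2 ∂P) atTop (𝓝 0)) :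
    Tendsto (fun n => ∫ ω, |X n ω| ∂P) atTop (𝓝 0) := by
  have h1 : Tendsto (fun n => √(∫ ω, X n ω ^ 2 ∂P)) atTop (𝓝 0) := by
    simpa [Function.comp_def] using (Real.continuous_sqrt.tendsto 0).comp h
  refine squeeze_zero (fun n => integral_nonneg fun ω => abs_nonneg _) (fun n => ?_) h1
  apply Real.le_sqrt_of_sq_le
  have := sq_integral_le_integral_sq (hX n).abs
  simpa [sq_abs] using this

end Convergence

/-! ### Law of large numbers for the heights in continuous time -/

section Main

variable {d : ℕ} {Ω : Type*} [MeasurableSpace Ω] {P : Measure Ω} [IsProbabilityMeasure P]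

lemma IsSubstrateSequence.tendsto_inv_card {Q : ℕ → Finset (Fin d → ℤ)}
    (hQ : IsSubstrateSequence Q) : Tendsto (fun n => ((Q n).card : ℝ)⁻¹) atTop (𝓝 0) :=
  tendsto_inv_atTop_zero.comp (tendsto_natCast_atTop_atTop.comp
    (strictMono_nat_of_lt_succ hQ.card_lt).tendsto_atTop)

lemma IsSubstrateSequence.tendsto_card_filter_div {Q : ℕ → Finset (Fin d → ℤ)}
    (hQ : IsSubstrateSequence Q) (W : Finset (Fin d → ℤ)) :
    Tendsto (fun n => (((Q n).filter fun z => ∃ w ∈ W, z - w ∉ Q n).card : ℝ) / (Q n).card)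
      atTop (𝓝 0) := by
  obtain ⟨K, hK⟩ := exists_card_filter_le_boundarySites W
  have h := hQ.boundary.mul_const (K : ℝ)
  rw [zero_mul] at h
  refine squeeze_zero (fun n => by positivity) (fun n => ?_) h
  rw [div_mul_eq_mul_div]
  gcongr
  exact_mod_cast hK (Q n)

/-- First `R` is chosen to make the exponential term small; with `R` fixed, the boundary and
variance terms vanish as `n → ∞`. -/
lemma IsSubstrateSequence.tendsto_zero_of_forall_le {Q : ℕ → Finset (Fin d → ℤ)}
    (hQ : IsSubstrateSequence Q) (V : Finset (Fin d → ℤ)) {B : ℝ} {a : ℕ → ℝ} (ha : ∀ n, 0 ≤ a n)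
    (h : ∀ n (R : ℕ), a n ≤ B * (24 * Real.exp (-(R / 2))
        + 12 * (((Q n).filter fun z => ∃ w ∈ stepBall V R, z - w ∉ Q n).card / (Q n).card)
        + 3 * ((stepBall V R - stepBall V R).card / (Q n).card))) :
    Tendsto a atTop (𝓝 0) := by
  refine tendsto_order.2 ⟨fun x hx => Eventually.of_forall fun n => hx.trans_le (ha n),
    fun ε hε => ?_⟩
  have hR : Tendsto (fun R : ℕ => B * (24 * Real.exp (-((R : ℝ) / 2)))) atTop (𝓝 0) := by
    have h1 : Tendsto (fun R : ℕ => Real.exp (-((R : ℝ) / 2))) atTop (𝓝 0) :=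
      Real.tendsto_exp_neg_atTop_nhds_zero.comp
        (tendsto_natCast_atTop_atTop.atTop_div_const two_pos)
    simpa using (h1.const_mul 24).const_mul B
  obtain ⟨R, hRε⟩ := (hR.eventually (gt_mem_nhds hε)).exists
  have hn : Tendsto (fun n => B * (24 * Real.exp (-((R : ℝ) / 2))
        + 12 * (((Q n).filter fun z => ∃ w ∈ stepBall V R, z - w ∉ Q n).card / (Q n).card)
        + 3 * ((stepBall V R - stepBall V R).card / (Q n).card)))
      atTop (𝓝 (B * (24 * Real.exp (-((R : ℝ) / 2)) + 12 * 0 + 3 * 0))) := by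
    refine (((hQ.tendsto_card_filter_div (stepBall V R)).const_mul 12).const_add _ |>.add
      (Tendsto.const_mul 3 ?_)).const_mul B
    simpa [div_eq_mul_inv] using
      hQ.tendsto_inv_card.const_mul ((stepBall V R - stepBall V R).card : ℝ)
  rw [mul_zero, mul_zero, add_zero, add_zero] at hn
  filter_upwards [hn.eventually (gt_mem_nhds hRε)] with n hlt
  exact (h n R).trans_lt hlt

variable {D : (Fin d → ℤ) → EReal} {N : (Fin d → ℤ) → ℝ≥0 → Ω → ℕ} {f : ℝ → ℝ} {C K : ℝ}

lemma expBound_nonneg (V : Finset (Fin d → ℤ)) (t : ℝ≥0) : 0 ≤ expBound V t :=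
  (Real.exp_pos _).le

namespace IsAdmissible

lemma memLp_bdHeight (hD : IsDisplacement D) (hN : IsPoissonArrivals N P)
    (hf : IsAdmissible (neighbourhood hD) (fun v => (D v).toReal) f C K) (t : ℝ≥0)
    (z : Fin d → ℤ) : MemLp (fun ω => f (bdHeight D (arrivalTimes N ω) t z)) 2 P := by
  refine (memLp_two_and_integral_sq_le_of_tendsto
    (fun M => hf.memLp_cellHeight (neighbourhood_nonempty hD) (isIIDCells_arrivalCells hN _)
      (one_add_mesh_pow_le _ t M) Set.univ z)
    (fun M => hf.integral_sq_cellHeight_le (neighbourhood_nonempty hD)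
      (isIIDCells_arrivalCells hN _) (expBound_nonneg _ t) (one_add_mesh_pow_le _ t M) Set.univ z)
    ?_).1
  filter_upwards [ae_eventually_cellHeight_eq hN hD t] with ω hω
  exact tendsto_const_nhds.congr' ((hω z).mono fun M hM => congrArg f hM.symm)

lemma tendsto_integral_cellHeight (hD : IsDisplacement D) (hN : IsPoissonArrivals N P)
    (hf : IsAdmissible (neighbourhood hD) (fun v => (D v).toReal) f C K) (t : ℝ≥0)
    (z : Fin d → ℤ) :
    Tendsto (fun M => ∫ ω, f (cellHeight (neighbourhood hD) (neighbourhood_nonempty hD)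
        (fun v => (D v).toReal) (arrivalCells N (mesh t M)) Set.univ (M + 1) z ω) ∂P) atTop
      (𝓝 (∫ ω, f (bdHeight D (arrivalTimes N ω) t z) ∂P)) := by
  refine tendsto_integral_of_tendsto_ae_of_integral_sq_le
    (fun M => hf.memLp_cellHeight (neighbourhood_nonempty hD) (isIIDCells_arrivalCells hN _)
      (one_add_mesh_pow_le _ t M) Set.univ z)
    (fun M => hf.integral_sq_cellHeight_le (neighbourhood_nonempty hD)
      (isIIDCells_arrivalCells hN _) (expBound_nonneg _ t) (one_add_mesh_pow_le _ t M) Set.univ z)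
    ?_
  filter_upwards [ae_eventually_cellHeight_eq hN hD t] with ω hω
  exact tendsto_const_nhds.congr' ((hω z).mono fun M hM => congrArg f hM.symm)

lemma memLp_bdHeight_restrict (hD : IsDisplacement D) (hN : IsPoissonArrivals N P)
    (hf : IsAdmissible (neighbourhood hD) (fun v => (D v).toReal) f C K) (t : ℝ≥0)
    (Q : Finset (Fin d → ℤ)) (z : Fin d → ℤ) :
    MemLp (fun ω => f (bdHeight D (restrictArrivals (arrivalTimes N ω) Q) t z)) 2 P := by
  refine (memLp_two_and_integral_sq_le_of_tendsto
    (fun M => hf.memLp_cellHeight (neighbourhood_nonempty hD) (isIIDCells_arrivalCells hN _)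
      (one_add_mesh_pow_le _ t M) Q z)
    (fun M => hf.integral_sq_cellHeight_le (neighbourhood_nonempty hD)
      (isIIDCells_arrivalCells hN _) (expBound_nonneg _ t) (one_add_mesh_pow_le _ t M) Q z)
    ?_).1
  filter_upwards [ae_eventually_cellHeight_restrict_eq hN hD t Q] with ω hω
  exact tendsto_const_nhds.congr' ((hω z).mono fun M hM => congrArg f hM.symm)

end IsAdmissible

/-- The mean of `f` over the heights on the substrate `Q`. -/
def heightAverage (D : (Fin d → ℤ) → EReal) (f : ℝ → ℝ) (A : (Fin d → ℤ) → Set ℝ≥0)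
    (Q : Finset (Fin d → ℤ)) (t : ℝ≥0) : ℝ :=
  (Q.card : ℝ)⁻¹ * ∑ z ∈ Q, f (bdHeight D (restrictArrivals A Q) t z)

namespace IsAdmissible

lemma memLp_heightAverage (hD : IsDisplacement D) (hN : IsPoissonArrivals N P)
    (hf : IsAdmissible (neighbourhood hD) (fun v => (D v).toReal) f C K) (t : ℝ≥0)
    (Q : Finset (Fin d → ℤ)) :
    MemLp (fun ω => heightAverage D f (arrivalTimes N ω) Q t) 2 P :=
  (memLp_finsetSum Q fun z _ => hf.memLp_bdHeight_restrict hD hN t Q z).const_mul _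

/-- Law of large numbers for the heights. -/
theorem tendsto_integral_sq_heightAverage (hD : IsDisplacement D) (hN : IsPoissonArrivals N P)
    (hf : IsAdmissible (neighbourhood hD) (fun v => (D v).toReal) f C K) (t : ℝ≥0)
    {Q : ℕ → Finset (Fin d → ℤ)} (hQ : IsSubstrateSequence Q) :
    Tendsto (fun n => ∫ ω, (heightAverage D f (arrivalTimes N ω) (Q n) t
      - ∫ ω', f (bdHeight D (arrivalTimes N ω') t 0) ∂P) ^ 2 ∂P) atTop (𝓝 0) := by
  refine hQ.tendsto_zero_of_forall_le (neighbourhood hD)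
    (B := K * expBound (neighbourhood hD) t)
    (fun n => integral_nonneg fun ω => sq_nonneg _) fun n R => ?_
  have hV := neighbourhood_nonempty hD
  have hiid := fun M => isIIDCells_arrivalCells hN (mesh t M)
  have hΓ := fun M => one_add_mesh_pow_le (neighbourhood hD) t M
  have hΓ0 := expBound_nonneg (neighbourhood hD) t
  -- For fixed `n` and `R` the discrete bound does not depend on the mesh, so it survives the limit.
  -- The centring constants also converge, to the mean of `f` of the true height at the origin.
  refine (memLp_two_and_integral_sq_le_of_tendsto
    (X := fun M ω => ((Q n).card : ℝ)⁻¹ * ∑ z ∈ Q n, f (cellHeight (neighbourhood hD) hV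
        (fun v => (D v).toReal) (arrivalCells N (mesh t M)) (Q n) (M + 1) z ω)
      - ∫ ω, f (cellHeight (neighbourhood hD) hV (fun v => (D v).toReal)
        (arrivalCells N (mesh t M)) Set.univ (M + 1) 0 ω) ∂P)
    (fun M => ?_) (fun M => hf.integral_sq_average_sub_integral_le hV (hiid M) hΓ0 (hΓ M) R
      ⟨0, hQ.zero_mem n⟩) ?_).2
  · exact ((memLp_finsetSum _ fun z _ =>
      hf.memLp_cellHeight hV (hiid M) (hΓ M) (Q n) z).const_mul _).sub (memLp_const _)
  · filter_upwards [ae_eventually_cellHeight_restrict_eq hN hD t (Q n)] with ω hω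
    refine Tendsto.sub ?_ (hf.tendsto_integral_cellHeight hD hN t 0)
    refine (tendsto_finsetSum _ fun z _ => ?_).const_mul _
    exact tendsto_const_nhds.congr' ((hω z).mono fun M hM => congrArg f hM.symm)

end IsAdmissible

/-- The growth condition is y^m / m! ≤ exp y with y = x/(2C) and m = 2k. The summand 1 in `C`
ensures positivity. -/
lemma exists_isAdmissible_pow (hD : IsDisplacement D) (k : ℕ) :
    ∃ C K, IsAdmissible (neighbourhood hD) (fun v => (D v).toReal) (fun x => x ^ k) C K := by
  let C : ℝ := ∑ v ∈ neighbourhood hD, |(D v).toReal| + 1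
  have hC : 0 < C := by positivity
  refine ⟨C, (2 * C) ^ (k * 2) * (k * 2).factorial, zero_mem_neighbourhood hD, ?_, hC,
    fun v hv => ?_, measurable_id.pow_const k, by positivity, fun x hx => ?_⟩
  · simp [hD.zero]
  · have h1 := Finset.single_le_sum (f := fun v => |(D v).toReal|) (fun v _ => abs_nonneg _) hv
    have h2 := le_abs_self (D v).toReal
    linarith
  · have h := Real.pow_div_factorial_le_exp (x / (2 * C)) (by positivity) (k * 2)
    rw [← pow_mul]
    rw [div_le_iff₀ (by positivity), div_pow, div_le_iff₀ (by positivity)] at h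
    linarith

lemma bdMeanHeight_eq_heightAverage (A : (Fin d → ℤ) → Set ℝ≥0) (Q : Finset (Fin d → ℤ))
    (t : ℝ≥0) : bdMeanHeight D A Q t = heightAverage D (fun x => x ^ 1) A Q t := by
  simp [bdMeanHeight, heightAverage]

lemma bdWidth_sq_eq (A : (Fin d → ℤ) → Set ℝ≥0) {Q : Finset (Fin d → ℤ)} (hQ : Q.Nonempty)
    (t : ℝ≥0) : bdWidth D A Q t ^ 2
      = heightAverage D (fun x => x ^ 2) A Q t - heightAverage D (fun x => x ^ 1) A Q t ^ 2 := by
  have hc : (0 : ℝ) < Q.card := by exact_mod_cast hQ.card_pos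
  rw [bdWidth, Real.sq_sqrt (by positivity), bdMeanHeight_eq_heightAverage]
  set a := heightAverage D (fun x => x ^ 1) A Q t with ha
  have ha' : ∑ z ∈ Q, bdHeight D (restrictArrivals A Q) t z = Q.card * a := by
    rw [ha, heightAverage]
    field_simp
  have h1 : ∀ z, (bdHeight D (restrictArrivals A Q) t z - a) ^ 2
      = bdHeight D (restrictArrivals A Q) t z ^ 2
        - 2 * a * bdHeight D (restrictArrivals A Q) t z + a ^ 2 := fun z => by ring
  simp_rw [h1, Finset.sum_add_distrib, Finset.sum_sub_distrib, ← Finset.mul_sum, ha', heightAverage,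
    Finset.sum_const, nsmul_eq_mul]
  field_simp
  ring

end Main

end

theorem proposition2p2 {d : ℕ} (D : (Fin d → ℤ) → EReal) (hD : IsDisplacement D)
    (Q : ℕ → Finset (Fin d → ℤ)) (hQ : IsSubstrateSequence Q)
    {Ω : Type*} [MeasurableSpace Ω] (P : Measure Ω) [IsProbabilityMeasure P]
    (N : (Fin d → ℤ) → ℝ≥0 → Ω → ℕ) (hN : IsPoissonArrivals N P)
    (t : ℝ≥0) (ht : 0 < t) :
    -- the heights are well defined, for the infinite substrate and for the finite ones
    (∀ᵐ ω ∂P, (∃! ξ, IsBDTrajectory D (arrivalTimes N ω) ξ) ∧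
      ∀ n, ∃! ξ, IsBDTrajectory D (restrictArrivals (arrivalTimes N ω) (Q n)) ξ) ∧
    -- the mean and the variance of the height at the origin are those of an `L²` variable
    MemLp (fun ω => bdHeight D (arrivalTimes N ω) t 0) 2 P ∧
    -- `L¹` convergence of the mean height
    (∀ n, MemLp (fun ω => bdMeanHeight D (arrivalTimes N ω) (Q n) t) 1 P) ∧
    Tendsto (fun n => eLpNorm (fun ω => bdMeanHeight D (arrivalTimes N ω) (Q n) t
        - ∫ ω', bdHeight D (arrivalTimes N ω') t 0 ∂P) 1 P) atTop (𝓝 0) ∧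
    -- `L¹` convergence of the squared width
    (∀ n, MemLp (fun ω => bdWidth D (arrivalTimes N ω) (Q n) t ^ 2) 1 P) ∧
    Tendsto (fun n => eLpNorm (fun ω => bdWidth D (arrivalTimes N ω) (Q n) t ^ 2
        - variance (fun ω' => bdHeight D (arrivalTimes N ω') t 0) P) 1 P) atTop (𝓝 0) := by
  obtain ⟨C1, K1, hf1⟩ := exists_isAdmissible_pow hD 1
  obtain ⟨C2, K2, hf2⟩ := exists_isAdmissible_pow hD 2
  set h := ∫ ω', bdHeight D (arrivalTimes N ω') t 0 ∂P with hh
  set s := ∫ ω', bdHeight D (arrivalTimes N ω') t 0 ^ 2 ∂P with hs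
  have hL2 : MemLp (fun ω => bdHeight D (arrivalTimes N ω) t 0) 2 P := by
    simpa using hf1.memLp_bdHeight hD hN t 0
  have hvar : variance (fun ω' => bdHeight D (arrivalTimes N ω') t 0) P = s - h ^ 2 :=
    variance_eq_sub hL2
  let a : ℕ → Ω → ℝ := fun n ω => heightAverage D (fun x => x ^ 1) (arrivalTimes N ω) (Q n) t
  let e : ℕ → Ω → ℝ := fun n ω => heightAverage D (fun x => x ^ 2) (arrivalTimes N ω) (Q n) t
  have ha : ∀ n, MemLp (a n) 2 P := fun n => hf1.memLp_heightAverage hD hN t (Q n)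
  have he : ∀ n, MemLp (e n) 2 P := fun n => hf2.memLp_heightAverage hD hN t (Q n)
  have hah : ∀ n, MemLp (fun ω => a n ω - h) 2 P := fun n => (ha n).sub (memLp_const h)
  have hes : ∀ n, MemLp (fun ω => e n ω - s) 2 P := fun n => (he n).sub (memLp_const s)
  have hta : Tendsto (fun n => ∫ ω, (a n ω - h) ^ 2 ∂P) atTop (𝓝 0) := by
    have := hf1.tendsto_integral_sq_heightAverage hD hN t hQ
    simp only [pow_one (bdHeight _ _ _ _)] at this
    exact this
  have hte : Tendsto (fun n => ∫ ω, (e n ω - s) ^ 2 ∂P) atTop (𝓝 0) :=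
    hf2.tendsto_integral_sq_heightAverage hD hN t hQ
  have hta1 := tendsto_integral_abs_of_tendsto_integral_sq hah hta
  have hte1 := tendsto_integral_abs_of_tendsto_integral_sq hes hte
  have hmean : ∀ n ω, bdMeanHeight D (arrivalTimes N ω) (Q n) t = a n ω := fun n ω =>
    bdMeanHeight_eq_heightAverage _ _ _
  have hwidth : ∀ n ω, bdWidth D (arrivalTimes N ω) (Q n) t ^ 2 = e n ω - a n ω ^ 2 := fun n ω =>
    bdWidth_sq_eq _ ⟨0, hQ.zero_mem n⟩ t
  have hW : ∀ n, Integrable (fun ω => e n ω - a n ω ^ 2) P := fun n =>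
    ((he n).integrable one_le_two).sub (ha n).integrable_sq
  simp_rw [hmean, hwidth, hvar]
  refine ⟨?_, hL2, fun n => memLp_one_iff_integrable.2 ((ha n).integrable one_le_two),
    tendsto_eLpNorm_one_of_tendsto_integral_abs (fun n => (hah n).integrable one_le_two) hta1,
    fun n => memLp_one_iff_integrable.2 (hW n),
    tendsto_eLpNorm_one_of_tendsto_integral_abs (fun n => (hW n).sub (integrable_const _)) ?_⟩
  · filter_upwards [ae_isFiniteHistory hN (zero_mem_neighbourhood hD)] with ω hω
    exact ⟨hω.existsUnique_trajectory hD, fun n =>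
      (hω.restrictArrivals (Q n)).existsUnique_trajectory hD⟩
  · have hlim := (hte1.add hta).add (hta1.const_mul (2 * |h|))
    rw [mul_zero, add_zero, add_zero] at hlim
    refine squeeze_zero (fun n => integral_nonneg fun ω => abs_nonneg _) (fun n => ?_) hlim
    have hI1 := ((hes n).integrable one_le_two).abs
    have hI2 := (hah n).integrable_sq
    have hI3 := (((hah n).integrable one_le_two).abs).const_mul (2 * |h|)
    have hI12 : Integrable (fun ω => |e n ω - s| + (a n ω - h) ^ 2) P := hI1.add hI2
    rw [← integral_const_mul, ← integral_add hI1 hI2, ← integral_add hI12 hI3]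
    refine integral_mono ((hW n).sub (integrable_const _)).abs (hI12.add hI3) fun ω => ?_
    -- Expanding the square about `h` leaves a quadratic error, which tends to 0 in L¹ because `a n`
    -- converges in L², and two linear errors.
    have h1 : e n ω - a n ω ^ 2 - (s - h ^ 2)
        = (e n ω - s) - (a n ω - h) ^ 2 - 2 * h * (a n ω - h) := by ring
    simp only [h1]
    refine (abs_sub _ _).trans ?_
    rw [abs_mul, abs_mul, abs_two]
    gcongr
    refine (abs_sub _ _).trans ?_
    rw [abs_of_nonneg (sq_nonneg (a n ω - h))]
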